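/- For even $n\ge 2$ consider the supermarket model on the dynamic perfect matching of $[n]=\{1,\dots,n\}$, with arrival rate $\lambda>0$ and graph speed $\kappa\ge 0$. This is the continuous-time Markov chain whose state consists of a queue length $Q^{(v)}\in\{0,1,2,\dots\}$ at every $v\in[n]$ and a perfect matching of $[n]$, with the following dynamics, independently at every vertex $v$. At rate $\lambda$ a task arrives at $v$ and joins the shorter of the queues at $v$ and at its current partner, a uniform one of the two in case of a tie. At rate $1$ one task is removed from the queue at $v$ if that queue is nonempty. At rate $\kappa$ the vertex $v$ picks a uniform $u\in[n]$ and swaps its membership in the matching with $u$: after the swap $v$ is matched to the former partner of $u$, and $u$ to that of $v$; nothing changes if $u=v$ or if $u$ and $v$ are partners. There is an absolute constant $\lambda_0>0$ such that for all $0<\lambda<\lambda_0$ and all $\kappa\ge 0$ the following holds. For every even $n\ge2$ the chain has a stationary distribution, and the law $\pi=\pi^{(n)}_\kappa$ on $\{0,1,2,\dots\}$ of a single queue $Q^{(i)}$ at stationarity is uniquely determined and is the same for every $i\in[n]$. The pointwise limit $\eta_\kappa=\lim_{n\to\infty}\pi^{(n)}_\kappa$ (along even $n$) exists and is a probability distribution,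 and for every even $n\ge 2$ $$\operatorname{d}_{\rm TV}\big(\pi^{(n)}_\kappa,\eta_\kappa\big)\le\frac1n ,$$ where $\operatorname{d}_{\rm TV}(p,q)=\sup_{A}|p(A)-q(A)|$, the supremum being over all sets $A$ of non-negative integers. -/

import Mathlib

/-- A perfect matching of `{0, …, n-1}` (an equal partition into hyperedges of size two), encoded
by the map sending every vertex to its partner: a fixed-point-free involution. -/
def PerfectMatching (n : ℕ) : Type :=
  {σ : Equiv.Perm (Fin n) // (∀ v, σ (σ v) = v) ∧ ∀ v, σ v ≠ v}

namespace Supermarket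

/-- A state of the system: the queue length at every vertex, and the current matching. -/
abbrev State (n : ℕ) : Type := (Fin n → ℕ) × PerfectMatching n

/-- The vertices `u` and `v` swap their membership of the partition: `u` becomes the partner of the
former partner of `v` and conversely (nothing changes if `u = v` or if they are partners). -/
def swapMembership {n : ℕ} (u v : Fin n) (M : PerfectMatching n) : PerfectMatching n :=
  ⟨Equiv.swap u v * M.1 * Equiv.swap u v, by
    obtain ⟨σ, h1, h2⟩ := M
    refine ⟨fun w => ?_, fun w hw => ?_⟩
    · simp [h1]
    · apply h2 (Equiv.swap u v w)
      have := congrArg (Equiv.swap u v) hw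
      simpa using this⟩

/-- The neighbourhood of `v`: the vertex itself and its current partner. -/
def nbhd {n : ℕ} (M : PerfectMatching n) (v : Fin n) : Finset (Fin n) := {v, M.1 v}

/-- The vertices carrying the shortest queues of the neighbourhood of `v`. -/
def shortest {n : ℕ} (s : State n) (v : Fin n) : Finset (Fin n) :=
  (nbhd s.2 v).filter fun u => ∀ w ∈ nbhd s.2 v, s.1 u ≤ s.1 w

/-- A task joins the queue at `u`. -/
def addTask {n : ℕ} (s : State n) (u : Fin n) : State n :=
  (Function.update s.1 u (s.1 u + 1), s.2)

/-- The server at `v` completes a task, if its queue is nonempty. -/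
def serve {n : ℕ} (s : State n) (v : Fin n) : State n :=
  (Function.update s.1 v (s.1 v - 1), s.2)

/-- The generator of the supermarket model on the dynamic perfect matching, with arrival rate `lam`
and graph speed `κ`. At every vertex `v` independently:
* at rate `lam` a task arrives and joins a uniform one of the shortest queues of the
  neighbourhood of `v`;
* at rate `1` the server at `v` completes a task;
* at rate `κ` the vertex `v` swaps its membership with that of a uniform vertex of all `n`. -/
noncomputable def generator (lam κ : ℝ) {n : ℕ} (f : State n → ℝ) (s : State n) : ℝ :=
  ∑ v : Fin n,
    (lam * (((shortest s v).card : ℝ)⁻¹ * ∑ u ∈ shortest s v, (f (addTask s u) - f s))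
      + (f (serve s v) - f s)
      + κ * ((n : ℝ)⁻¹ * ∑ u : Fin n, (f (s.1, swapMembership v u s.2) - f s)))

/-- `μ` is a stationary distribution of the continuous-time Markov chain: the generator of every
bounded function has mean zero. The total jump rate is bounded, so the generator is a
bounded operator `L` on bounded functions, the series converges absolutely, and the condition
is equivalent to `μ` being invariant under the transition semigroup `exp (t L)`. -/
def IsStationary (lam κ : ℝ) {n : ℕ} (μ : PMF (State n)) : Prop :=
  ∀ f : State n → ℝ, (∃ C : ℝ, ∀ s, |f s| ≤ C) →
    ∑' s, (μ s).toReal * generator lam κ f s = 0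

/-- `p` is the stationary distribution of a single queue in the system of size `n`: a stationary
distribution of the system exists, and under every such distribution the queue at every vertex
has law `p`. -/
def IsQueueLaw (lam κ : ℝ) (n : ℕ) (p : PMF ℕ) : Prop :=
  (∃ μ : PMF (State n), IsStationary lam κ μ) ∧
    ∀ μ : PMF (State n), IsStationary lam κ μ → ∀ i : Fin n, μ.map (fun s => s.1 i) = p

/-- Total variation distance of two probability distributions on `ℕ`. -/
noncomputable def tvDist (p q : PMF ℕ) : ℝ :=
  ⨆ A : Set ℕ, |(p.toMeasure A).toReal - (q.toMeasure A).toReal|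

end Supermarket

namespace Supermarket

/-! The proof tracks the joint tails D(m, M), the probability that every queue is at least as long
as m prescribes and the matching is M. For two choices these satisfy a closed linear system. If the
tagged queue has length exactly a - 1, the chance of a task joining it depends only on whether its
partner has length at least a - 1 and at least a, and products of tail indicators of one queue merge
through a maximum (`tailDrift_geInd`, `generator_tailInd`). Stationarity thus becomes
`tailGenerator` = 0.

In the supremum norm weighted by (1/2)^|m|, with |m| the sum of the entries of m, this system is
stable for small arrival rates (`tailGenerator_contraction`). A departure removes mass at rate one
for each nonzero entry and refers to a tail whose weight is halved, arrivals are a perturbation of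
order `lam`, and the swap term is harmless by a maximum principle over matchings. The stability
constant depends on neither n nor κ. Stability gives uniqueness of the normalised solution, and it
converts any approximate solution into an estimate.

The approximate solution is the product over matched pairs of a limiting pair tail y, which solves a
nonlinear equation in which the partner is refreshed by an independent copy at rate 4κ
(`exists_pairTail`). Inserting the product into the system leaves an error of order 1/n
(`abs_tailGenerator_pairProd_le`). This error is uniform in κ because every surviving term pairs the
factor κ with a correlation of y, and the pair equation itself bounds κ times the correlation
(`abs_correlation_le`).

Three further ingredients are needed. A Lyapunov function gives existence of a stationary
distribution and the a priori exponential decay of its tails (`exists_isStationary`,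
`IsStationary.jointTail_le`). Averaging over relabellings that fix one vertex normalises D(0, M)
even when κ = 0, where the law of the matching is not determined
(`IsStationary.exists_isTailSolution`). Summing the geometric tail estimates gives total variation
at most 12/(25n). -/

/-! ### The linear system for joint tails and its stability -/

/-- The drift of the tail function `F` in its first argument, when the second one is the partner. -/
noncomputable def tailDrift (lam : ℝ) (F : ℕ → ℕ → ℝ) (a b : ℕ) : ℝ :=
  if a = 0 then 0 else F (a + 1) b - F a b
    + lam * (F (a - 1) (max a b) + F (a - 1) (max (a - 1) b) - F a (max a b) - F a (max (a - 1) b))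

/-- The multi-index `m` with the entries at `v` and `w` replaced by `i` and `j`. -/
def setPair {n : ℕ} (m : Fin n → ℕ) (v w : Fin n) (i j : ℕ) : Fin n → ℕ :=
  Function.update (Function.update m v i) w j

/-- The action of the generator on joint tail functions `D m M`. -/
noncomputable def tailGenerator (lam κ : ℝ) {n : ℕ} (D : (Fin n → ℕ) → PerfectMatching n → ℝ)
    (m : Fin n → ℕ) (M : PerfectMatching n) : ℝ :=
  ∑ v : Fin n, tailDrift lam (fun i j => D (setPair m v (M.1 v) i j) M) (m v) (m (M.1 v))
    + κ * ((n : ℝ)⁻¹ * ∑ v : Fin n, ∑ u : Fin n, (D m (swapMembership v u M) - D m M))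

/-- The number of nonzero entries of a multi-index. -/
def active {n : ℕ} (m : Fin n → ℕ) : ℕ := (Finset.univ.filter fun v => m v ≠ 0).card

instance (n : ℕ) : Finite (PerfectMatching n) :=
  inferInstanceAs (Finite {σ : Equiv.Perm (Fin n) // (∀ v, σ (σ v) = v) ∧ ∀ v, σ v ≠ v})

noncomputable instance (n : ℕ) : Fintype (PerfectMatching n) := Fintype.ofFinite _

theorem setPair_self {n : ℕ} (m : Fin n → ℕ) (v w : Fin n) : setPair m v w (m v) (m w) = m := by
  simp [setPair]

theorem sum_setPair {n : ℕ} (m : Fin n → ℕ) {v w : Fin n} (h : w ≠ v) (i j : ℕ) :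
    ∑ x, setPair m v w i j x = i + j + ∑ x ∈ (Finset.univ.erase v).erase w, m x := by
  have hw : w ∈ Finset.univ.erase v := by simp [h]
  rw [← Finset.add_sum_erase _ _ (Finset.mem_univ v), ← Finset.add_sum_erase _ _ hw, ← add_assoc]
  congr 1
  · simp [setPair, h.symm]
  · refine Finset.sum_congr rfl fun x hx => ?_
    simp only [Finset.mem_erase] at hx
    simp [setPair, hx.1, hx.2.1]

theorem sum_eq_add_add {n : ℕ} (m : Fin n → ℕ) {v w : Fin n} (h : w ≠ v) :
    ∑ x, m x = m v + m w + ∑ x ∈ (Finset.univ.erase v).erase w, m x := by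
  conv_lhs => rw [← setPair_self m v w]
  exact sum_setPair m h _ _

/-- The maxima only raise the second index, so an arrival term loses at most one power of r against
the weight at (a, b). -/
theorem tailDrift_arrival_abs_le {lam : ℝ} (hl : 0 ≤ lam) {F : ℕ → ℕ → ℝ} {r S : ℝ} (hr : 0 < r)
    (hr1 : r ≤ 1) (hS : ∀ i j, |F i j| ≤ S * r ^ (i + j)) {a b : ℕ} (ha : a ≠ 0) :
    |tailDrift lam F a b + F a b - F (a + 1) b| ≤ 2 * lam * (1 + r⁻¹) * (S * r ^ (a + b)) := by
  obtain ⟨c, rfl⟩ := Nat.exists_eq_succ_of_ne_zero ha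
  have hS0 : 0 ≤ S := by simpa using (abs_nonneg _).trans (hS 0 0)
  have key : ∀ i j k : ℕ, k ≤ i + j → |F i j| ≤ S * r ^ k := fun i j k hk =>
    (hS i j).trans (mul_le_mul_of_nonneg_left (pow_le_pow_of_le_one hr.le hr1 hk) hS0)
  have h2 := key c (max (c + 1) b) (c + b) (by omega)
  have h3 := key c (max c b) (c + b) (by omega)
  have h4 := key (c + 1) (max (c + 1) b) (c + 1 + b) (by omega)
  have h5 := key (c + 1) (max c b) (c + 1 + b) (by omega)
  have e : r ^ (c + b) = r⁻¹ * r ^ (c + 1 + b) := by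
    rw [show c + 1 + b = c + b + 1 by ring, pow_succ]; field_simp
  rw [e] at h2 h3
  simp only [tailDrift, Nat.succ_eq_add_one, Nat.add_one_ne_zero, if_false, Nat.add_sub_cancel]
  set p := r ^ (c + 1 + b)
  have h6 : |F c (max (c + 1) b) + F c (max c b) - F (c + 1) (max (c + 1) b)
      - F (c + 1) (max c b)| ≤ 2 * (S * (r⁻¹ * p)) + 2 * (S * p) := by
    rw [abs_le] at *
    constructor <;> linarith
  rw [show ∀ x y z : ℝ, x - y + z + y - x = z by intros; ring, abs_mul, abs_of_nonneg hl]
  exact (mul_le_mul_of_nonneg_left h6 hl).trans (le_of_eq (by ring))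

theorem tailDrift_add_self_abs_le {lam : ℝ} (hl : 0 ≤ lam) {F : ℕ → ℕ → ℝ} {r S : ℝ} (hr : 0 < r)
    (hr1 : r ≤ 1) (hS : ∀ i j, |F i j| ≤ S * r ^ (i + j)) {a b : ℕ} (ha : a ≠ 0) :
    |tailDrift lam F a b + F a b| ≤ (r + 2 * lam * (1 + r⁻¹)) * (S * r ^ (a + b)) := by
  have h1 := tailDrift_arrival_abs_le hl hr hr1 hS (b := b) ha
  have h2 := hS (a + 1) b
  rw [show a + 1 + b = a + b + 1 by ring, pow_succ] at h2
  rw [abs_le] at *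
  constructor <;> linarith

/-- Each nonzero entry contributes -D plus a remainder of size (1/2 + 6 `lam`) times the weighted
norm. The number of nonzero entries therefore cancels, and the norm is bounded by a fraction of
itself plus ε. The bound A enters only to make the norm finite; its value plays no role in the
conclusion. -/
theorem tailGenerator_contraction {lam κ : ℝ} (hl : 0 ≤ lam) (hl' : lam ≤ 1 / 100) (hκ : 0 ≤ κ)
    {n : ℕ} {D : (Fin n → ℕ) → PerfectMatching n → ℝ} {A ε : ℝ}
    (hA : ∀ m M, |D m M| ≤ A * (1 / 2) ^ (∑ v, m v)) (h0 : ∀ M, D 0 M = 0) (hε : 0 ≤ ε)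
    (hD : ∀ m M, |tailGenerator lam κ D m M| ≤ active m * (ε * (1 / 2) ^ (∑ v, m v)))
    (m : Fin n → ℕ) (M : PerfectMatching n) : |D m M| ≤ 4 * ε * (1 / 2) ^ (∑ v, m v) := by
  have step : ∀ S : ℝ, (∀ m M, |D m M| ≤ S * (1 / 2) ^ (∑ v, m v)) →
      ∀ m M, |D m M| ≤ ((1 / 2 + 6 * lam) * S + ε) * (1 / 2) ^ (∑ v, m v) := by
    intro S hS m M
    have hS0 : 0 ≤ S := by simpa [h0] using hS 0 M
    rcases eq_or_ne m 0 with rfl | hm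
    · rw [h0]; simp; positivity
    set p : ℝ := (1 / 2) ^ (∑ v, m v)
    have : Nonempty (PerfectMatching n) := ⟨M⟩
    -- Maximum principle: where |D m ·| is largest, the swap term points towards zero and can be
    -- dropped, whatever κ is.
    obtain ⟨M₀, hM₀⟩ := Finite.exists_max fun M => |D m M|
    refine (hM₀ M).trans ?_
    have hk : 0 < active m := by
      obtain ⟨v, hv⟩ := Function.ne_iff.mp hm
      exact Finset.card_pos.mpr ⟨v, by simpa using hv⟩
    have hk' : (0 : ℝ) < active m := by exact_mod_cast hk
    set x := D m M₀
    set q : Fin n → ℝ := fun v =>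
      tailDrift lam (fun i j => D (setPair m v (M₀.1 v) i j) M₀) (m v) (m (M₀.1 v)) with hq
    have hsum : |∑ v, q v + active m * x| ≤ active m * ((1 / 2 + 6 * lam) * (S * p)) := by
      have e1 : ∑ v, q v + active m * x
          = ∑ v ∈ Finset.univ.filter (fun v => m v ≠ 0), (q v + x) := by
        rw [Finset.sum_add_distrib, Finset.sum_const, nsmul_eq_mul, active, Finset.sum_filter_of_ne]
        intro v _ hv hmv
        exact hv (by simp [hq, tailDrift, hmv])
      rw [e1]
      refine (Finset.abs_sum_le_sum_abs _ _).trans ?_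
      rw [active, ← nsmul_eq_mul]
      refine Finset.sum_le_card_nsmul _ _ _ fun v hv => ?_
      have hne := M₀.2.2 v
      have hF : ∀ i j, |D (setPair m v (M₀.1 v) i j) M₀| ≤
          (S * (1 / 2) ^ (∑ x ∈ (Finset.univ.erase v).erase (M₀.1 v), m x)) * (1 / 2) ^ (i + j) := by
        intro i j
        refine (hS _ _).trans (le_of_eq ?_)
        rw [sum_setPair m hne, pow_add]; ring
      have := tailDrift_add_self_abs_le hl (by norm_num) (by norm_num) hF
        (a := m v) (b := m (M₀.1 v)) (by simpa using hv)
      simp only [setPair_self] at this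
      refine this.trans (le_of_eq ?_)
      rw [show p = (1 / 2) ^ (m v + m (M₀.1 v)) *
        (1 / 2) ^ (∑ x ∈ (Finset.univ.erase v).erase (M₀.1 v), m x) by
          rw [← pow_add, ← sum_eq_add_add m hne]]
      ring
    have hT := hD m M₀
    rw [tailGenerator] at hT
    set T := ∑ v : Fin n, ∑ u : Fin n, (D m (swapMembership v u M₀) - x)
    have hTp : 0 ≤ x → κ * ((n : ℝ)⁻¹ * T) ≤ 0 := fun h => by
      refine mul_nonpos_of_nonneg_of_nonpos hκ (mul_nonpos_of_nonneg_of_nonpos (by positivity) ?_)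
      refine Finset.sum_nonpos fun v _ => Finset.sum_nonpos fun u _ => ?_
      have := hM₀ (swapMembership v u M₀)
      simp only [abs_of_nonneg h] at this
      linarith [le_abs_self (D m (swapMembership v u M₀))]
    have hTn : x ≤ 0 → 0 ≤ κ * ((n : ℝ)⁻¹ * T) := fun h => by
      refine mul_nonneg hκ (mul_nonneg (by positivity) ?_)
      refine Finset.sum_nonneg fun v _ => Finset.sum_nonneg fun u _ => ?_
      have := hM₀ (swapMembership v u M₀)
      simp only [abs_of_nonpos h] at this
      linarith [neg_abs_le (D m (swapMembership v u M₀))]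
    refine le_of_mul_le_mul_left ?_ hk'
    rw [abs_le] at hsum hT
    change _ * |x| ≤ _
    rcases le_total 0 x with h | h
    · rw [abs_of_nonneg h]; linarith [hTp h]
    · rw [abs_of_nonpos h]; linarith [hTn h]
  have hne : Nonempty ((Fin n → ℕ) × PerfectMatching n) := ⟨(m, M)⟩
  set f : (Fin n → ℕ) × PerfectMatching n → ℝ := fun s => |D s.1 s.2| * 2 ^ (∑ v, s.1 v) with hf
  have conv : ∀ (C : ℝ) m M, |D m M| ≤ C * (1 / 2) ^ (∑ v, m v) ↔ f (m, M) ≤ C := by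
    intro C m M
    rw [hf, one_div, inv_pow, ← div_eq_mul_inv, le_div_iff₀ (by positivity)]
  have hb : BddAbove (Set.range f) := ⟨A, by rintro _ ⟨s, rfl⟩; exact (conv A _ _).1 (hA _ _)⟩
  have h1 := step (⨆ s, f s) fun m M => (conv _ _ _).2 (le_ciSup hb (m, M))
  have h2 : (⨆ s, f s) ≤ (1 / 2 + 6 * lam) * (⨆ s, f s) + ε :=
    ciSup_le fun s => (conv _ _ _).1 (h1 s.1 s.2)
  have h3 : 0 ≤ ⨆ s, f s := Real.iSup_nonneg fun s => by positivity
  -- Here 1/2 + 6 `lam` ≤ 0.56, so the norm is at most ε / 0.44, which is below 4ε.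
  exact (conv _ _ _).2 ((le_ciSup hb (m, M)).trans (by nlinarith))

/-! ### The limiting pair tail as a fixed point -/

/-- The map whose fixed points are the limiting joint tails of the queues of a matched pair. -/
noncomputable def pairMap (lam κ : ℝ) (F : ℕ → ℕ → ℝ) (a b : ℕ) : ℝ :=
  if a = 0 ∧ b = 0 then 1 else
    ((if a = 0 then 0 else tailDrift lam F a b + F a b)
      + (if b = 0 then 0 else tailDrift lam F b a + F b a)
      + (if a = 0 ∨ b = 0 then 0 else 4 * κ * (F a 0 * F b 0)))
    / ((if a = 0 then 0 else 1) + (if b = 0 then 0 else 1)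
      + (if a = 0 ∨ b = 0 then 0 else 4 * κ))

theorem pairMap_comm (lam κ : ℝ) (F : ℕ → ℕ → ℝ) (a b : ℕ) :
    pairMap lam κ F a b = pairMap lam κ F b a := by
  simp only [pairMap, and_comm, or_comm, mul_comm (F a 0)]
  congr 2 <;> ring

theorem continuous_tailDrift (lam : ℝ) (a b : ℕ) :
    Continuous fun F : ℕ → ℕ → ℝ => tailDrift lam F a b := by
  unfold tailDrift
  split_ifs <;> fun_prop

theorem continuous_pairMap (lam κ : ℝ) : Continuous (pairMap lam κ) := by
  have := continuous_tailDrift lam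
  refine continuous_pi fun a => continuous_pi fun b => ?_
  unfold pairMap
  by_cases ha : a = 0 <;> by_cases hb : b = 0 <;> simp only [ha, hb, and_self, and_false, false_and,
    or_self, or_false, or_true, if_true, if_false] <;> fun_prop

/-- Tail functions that are at most `δ * 4 ^ (-(a + b))` away from the origin. -/
def IsSmallTail (δ : ℝ) (F : ℕ → ℕ → ℝ) : Prop :=
  F 0 0 = 1 ∧ ∀ a b, (a ≠ 0 ∨ b ≠ 0) → |F a b| ≤ δ * (1 / 4) ^ (a + b)

theorem IsSmallTail.abs_le_pow {δ : ℝ} (hδ : δ ≤ 1) {F : ℕ → ℕ → ℝ} (hF : IsSmallTail δ F) (a b : ℕ) :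
    |F a b| ≤ 1 * (1 / 4) ^ (a + b) := by
  by_cases h : a ≠ 0 ∨ b ≠ 0
  · exact (hF.2 a b h).trans (by gcongr)
  · push Not at h
    simp [h.1, h.2, hF.1]

theorem IsSmallTail.abs_drift_le {lam : ℝ} (hl : 0 ≤ lam) (hl' : lam ≤ 1 / 2000) {F : ℕ → ℕ → ℝ}
    (hF : IsSmallTail (1 / 100) F) {a b : ℕ} (ha : a ≠ 0) :
    |tailDrift lam F a b + F a b| ≤ 3 / 400 * (1 / 4) ^ (a + b) := by
  have h1 := tailDrift_arrival_abs_le hl (by norm_num) (by norm_num)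
    (hF.abs_le_pow (by norm_num)) (b := b) ha
  have h2 := hF.2 (a + 1) b (by simp)
  rw [show a + 1 + b = a + b + 1 by ring, pow_succ] at h2
  have hp : (0 : ℝ) < (1 / 4) ^ (a + b) := by positivity
  set p : ℝ := (1 / 4) ^ (a + b)
  have h3 : 2 * lam * (1 + (1 / 4 : ℝ)⁻¹) * (1 * p) ≤ 1 / 200 * p := by
    have : lam * p ≤ 1 / 2000 * p := by gcongr
    norm_num; linarith
  rw [abs_le] at *
  constructor <;> linarith

theorem abs_div_le_of_le {x d c : ℝ} (hd : 0 < d) (h : |x| ≤ c * d) : |x / d| ≤ c := by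
  rwa [abs_div, abs_of_pos hd, div_le_iff₀ hd]

/-- Away from the origin `pairMap` is a weighted average with weights 1, 1 and 4κ, so bounding each
averaged quantity suffices and κ drops out. The refresh term is a product of two small tails, hence
smaller still. -/
theorem IsSmallTail.pairMap {lam κ : ℝ} (hl : 0 ≤ lam) (hl' : lam ≤ 1 / 2000) (hκ : 0 ≤ κ)
    {F : ℕ → ℕ → ℝ} (hF : IsSmallTail (1 / 100) F) :
    IsSmallTail (1 / 100) (pairMap lam κ F) := by
  refine ⟨by simp [Supermarket.pairMap], fun a b hab => ?_⟩
  have hp : (0 : ℝ) < (1 / 4) ^ (a + b) := by positivity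
  have hd : a ≠ 0 → |tailDrift lam F a b + F a b| ≤ 3 / 400 * (1 / 4) ^ (a + b) :=
    fun ha => hF.abs_drift_le hl hl' ha
  have hd' : b ≠ 0 → |tailDrift lam F b a + F b a| ≤ 3 / 400 * (1 / 4) ^ (a + b) :=
    fun hb => add_comm a b ▸ hF.abs_drift_le hl hl' hb
  have hm : a ≠ 0 → b ≠ 0 → |4 * κ * (F a 0 * F b 0)| ≤ 4 * κ * (1 / 100 * (1 / 4) ^ (a + b)) := by
    intro ha hb
    have h1 := hF.2 a 0 (Or.inl ha)
    have h2 := hF.2 b 0 (Or.inl hb)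
    rw [abs_mul, abs_mul (F a 0), abs_of_nonneg (by positivity : 0 ≤ 4 * κ)]
    refine mul_le_mul_of_nonneg_left ?_ (by positivity)
    refine (mul_le_mul h1 h2 (abs_nonneg _) (by positivity)).trans ?_
    rw [add_zero, add_zero, pow_add]
    have : (0 : ℝ) < (1 / 4) ^ a * (1 / 4) ^ b := by positivity
    linarith
  set p : ℝ := (1 / 4) ^ (a + b)
  unfold Supermarket.pairMap
  by_cases ha : a = 0
  · have hb : b ≠ 0 := by tauto
    subst ha
    simp only [hb, and_false, if_false, if_true, true_or]
    refine abs_div_le_of_le (by norm_num) ?_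
    simp only [zero_add, add_zero, mul_one]
    exact (hd' hb).trans (by linarith)
  · by_cases hb : b = 0
    · subst hb
      simp only [ha, false_and, if_false, if_true, or_true]
      refine abs_div_le_of_le (by norm_num) ?_
      simp only [add_zero, mul_one]
      exact (hd ha).trans (by linarith)
    · simp only [ha, hb, false_and, if_false, or_self]
      refine abs_div_le_of_le (by positivity) ?_
      refine (abs_add_three _ _ _).trans ?_
      linarith [hd ha, hd' hb, hm ha hb]

theorem tailDrift_sub (lam : ℝ) (F G : ℕ → ℕ → ℝ) (a b : ℕ) :
    tailDrift lam F a b - tailDrift lam G a b = tailDrift lam (fun i j => F i j - G i j) a b := by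
  unfold tailDrift
  split_ifs <;> ring

/-- Each averaged quantity contracts on its own: the drift part by 1/4 + 10 `lam`, and the quadratic
refresh part by 2/100 because both of its factors are small. -/
theorem pairMap_sub_abs_le {lam κ : ℝ} (hl : 0 ≤ lam) (hl' : lam ≤ 1 / 2000) (hκ : 0 ≤ κ)
    {F G : ℕ → ℕ → ℝ} (hF : IsSmallTail (1 / 100) F) (hG : IsSmallTail (1 / 100) G) {d : ℝ}
    (hd : ∀ a b, |F a b - G a b| ≤ d * (1 / 4) ^ (a + b)) (a b : ℕ) :
    |pairMap lam κ F a b - pairMap lam κ G a b| ≤ d / 2 * (1 / 4) ^ (a + b) := by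
  have hd0 : 0 ≤ d := by simpa using (abs_nonneg _).trans (hd 0 0)
  have hs : ∀ a b, a ≠ 0 → |(tailDrift lam F a b + F a b) - (tailDrift lam G a b + G a b)|
      ≤ d / 2 * (1 / 4) ^ (a + b) := by
    intro a b ha
    rw [add_sub_add_comm, tailDrift_sub]
    refine (tailDrift_add_self_abs_le hl (by norm_num) (by norm_num) hd ha).trans ?_
    rw [← mul_assoc]
    gcongr
    have : lam * d ≤ 1 / 2000 * d := by gcongr
    norm_num; linarith
  have hm : a ≠ 0 → b ≠ 0 → |4 * κ * (F a 0 * F b 0) - 4 * κ * (G a 0 * G b 0)|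
      ≤ 4 * κ * (d / 2 * (1 / 4) ^ (a + b)) := by
    intro ha hb
    have h1 := hF.2 a 0 (Or.inl ha)
    have h2 := hG.2 b 0 (Or.inl hb)
    have h3 := hd a 0
    have h4 := hd b 0
    rw [← mul_sub, abs_mul, abs_of_nonneg (by positivity : 0 ≤ 4 * κ)]
    gcongr
    rw [show F a 0 * F b 0 - G a 0 * G b 0
      = F a 0 * (F b 0 - G b 0) + (F a 0 - G a 0) * G b 0 by ring]
    refine (abs_add_le _ _).trans ?_
    rw [abs_mul, abs_mul]
    have e1 := mul_le_mul h1 h4 (abs_nonneg _) (by positivity)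
    have e2 := mul_le_mul h3 h2 (abs_nonneg _) (by positivity)
    rw [add_zero, add_zero] at e1 e2
    rw [pow_add]
    have : 0 ≤ d * ((1 / 4) ^ a * (1 / 4) ^ b) := by positivity
    linarith
  have hs1 := hs a b
  have hs2 := hs b a
  rw [add_comm b a] at hs2
  set p : ℝ := (1 / 4) ^ (a + b)
  unfold pairMap
  by_cases ha : a = 0
  · by_cases hb : b = 0
    · simp only [ha, hb, and_self, if_true, sub_self, abs_zero]; positivity
    subst ha
    simp only [hb, and_false, if_false, if_true, true_or]
    rw [← sub_div]
    refine abs_div_le_of_le (by norm_num) ?_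
    simp only [zero_add, add_zero, mul_one]
    exact hs2 hb
  · by_cases hb : b = 0
    · subst hb
      simp only [ha, false_and, if_false, if_true, or_true]
      rw [← sub_div]
      refine abs_div_le_of_le (by norm_num) ?_
      simp only [add_zero, mul_one]
      exact hs1 ha
    · simp only [ha, hb, false_and, if_false, or_self]
      rw [← sub_div]
      refine abs_div_le_of_le (by positivity) ?_
      rw [add_sub_add_comm, add_sub_add_comm]
      refine (abs_add_three _ _ _).trans ?_
      linarith [hs1 ha, hs2 hb, hm ha hb]

/-- Picard iteration of `pairMap` from the tail of a pair of empty queues. The rate 4κ arises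
because each vertex of the pair both initiates swaps and is picked for them, each at rate κ. -/
theorem exists_pairTail {lam κ : ℝ} (hl : 0 ≤ lam) (hl' : lam ≤ 1 / 2000) (hκ : 0 ≤ κ) :
    ∃ y : ℕ → ℕ → ℝ, IsSmallTail (1 / 100) y ∧ (∀ a b, y a b = y b a) ∧
      ∀ a b, tailDrift lam y a b + tailDrift lam y b a + 4 * κ * (y a 0 * y b 0 - y a b) = 0 := by
  set y₀ : ℕ → ℕ → ℝ := fun a b => if a = 0 ∧ b = 0 then 1 else 0 with hy₀
  set Y : ℕ → ℕ → ℕ → ℝ := fun j => (pairMap lam κ)^[j] y₀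
  have hY : ∀ j, IsSmallTail (1 / 100) (Y j) := by
    intro j
    induction j with
    | zero =>
      refine ⟨by simp [Y, hy₀], fun a b h => ?_⟩
      have : ¬ (a = 0 ∧ b = 0) := by tauto
      simp only [Y, hy₀, Function.iterate_zero, id, this, if_false, abs_zero]
      positivity
    | succ j ih =>
      simp only [Y, Function.iterate_succ_apply']
      exact ih.pairMap hl hl' hκ
  have hdiff : ∀ j a b, |Y j a b - Y (j + 1) a b| ≤ 2 / 2 ^ j * (1 / 4) ^ (a + b) := by
    intro j
    induction j with
    | zero =>
      intro a b
      refine (abs_sub _ _).trans ?_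
      have h1 := (hY 0).abs_le_pow (by norm_num) a b
      have h2 := (hY 1).abs_le_pow (by norm_num) a b
      norm_num at h1 h2 ⊢
      linarith
    | succ j ih =>
      intro a b
      have := pairMap_sub_abs_le hl hl' hκ (hY j) (hY (j + 1)) ih a b
      simp only [Y, Function.iterate_succ_apply'] at this ⊢
      refine this.trans (le_of_eq ?_)
      rw [pow_succ]; field_simp
  have hlim : ∀ a b, ∃ l, Filter.Tendsto (fun j => Y j a b) Filter.atTop (nhds l) := by
    intro a b
    refine cauchySeq_tendsto_of_complete (cauchySeq_of_le_geometric (1 / 2) 2 (by norm_num) ?_)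
    intro j
    rw [Real.dist_eq]
    refine (hdiff j a b).trans ?_
    rw [show (2 : ℝ) * (1 / 2) ^ j = 2 / 2 ^ j by rw [one_div, inv_pow, div_eq_mul_inv]]
    refine mul_le_of_le_one_right (by positivity) (pow_le_one₀ (by norm_num) (by norm_num))
  choose y hy using hlim
  have hyt : Filter.Tendsto Y Filter.atTop (nhds y) :=
    tendsto_pi_nhds.2 fun a => tendsto_pi_nhds.2 fun b => hy a b
  have hfix : pairMap lam κ y = y := by
    have h1 : Filter.Tendsto (fun j => Y (j + 1)) Filter.atTop (nhds y) :=
      hyt.comp (Filter.tendsto_add_atTop_nat 1)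
    have h2 := ((continuous_pairMap lam κ).tendsto y).comp hyt
    refine tendsto_nhds_unique h2 (h1.congr fun j => ?_)
    simp only [Y, Function.iterate_succ_apply', Function.comp]
  have hsymm : ∀ a b, y a b = y b a := fun a b => by rw [← hfix, pairMap_comm]
  have hsmall : IsSmallTail (1 / 100) y := by
    refine ⟨tendsto_nhds_unique (hy 0 0) ?_, fun a b h => ?_⟩
    · exact tendsto_const_nhds.congr fun j => ((hY j).1).symm
    · exact le_of_tendsto (hy a b).abs (Filter.Eventually.of_forall fun j => (hY j).2 a b h)
  refine ⟨y, hsmall, hsymm, fun a b => ?_⟩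
  have h := congrFun (congrFun hfix a) b
  rw [hsymm a b] at h ⊢
  unfold pairMap at h
  by_cases ha : a = 0
  · subst ha
    by_cases hb : b = 0
    · subst hb; simp [tailDrift, hsmall.1]
    · simp only [hb, and_false, if_false, if_true, true_or, zero_add, add_zero, div_one] at h
      rw [show tailDrift lam y 0 b = 0 by simp [tailDrift], hsmall.1]
      linarith
  · by_cases hb : b = 0
    · subst hb
      simp only [ha, false_and, if_false, if_true, or_true, add_zero, div_one] at h
      rw [show tailDrift lam y 0 a = 0 by simp [tailDrift], hsmall.1, hsymm 0 a]
      linarith [hsymm a 0]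
    · simp only [ha, hb, false_and, if_false, or_self] at h
      rw [div_eq_iff (by positivity), hsymm a b] at h
      linarith

/-- The pair equation expresses 4κ times the correlation through the two drifts, which are bounded
independently of κ. Fast rewiring thus forces correlations of order 1/κ. -/
theorem abs_correlation_le {lam κ : ℝ} (hl : 0 ≤ lam) (hl' : lam ≤ 1 / 2000)
    {y : ℕ → ℕ → ℝ} (hy : IsSmallTail (1 / 100) y) (hs : ∀ a b, y a b = y b a)
    (h : ∀ a b, tailDrift lam y a b + tailDrift lam y b a + 4 * κ * (y a 0 * y b 0 - y a b) = 0)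
    (a b : ℕ) : |κ * (y a b - y a 0 * y b 0)| ≤ 1 / 100 * (1 / 4) ^ (a + b) := by
  have hp : (0 : ℝ) < (1 / 4) ^ (a + b) := by positivity
  by_cases ha : a = 0
  · subst ha; rw [hy.1, hs 0 b]; simp
  by_cases hb : b = 0
  · subst hb; rw [hy.1]; simp
  have h1 := hy.abs_drift_le hl hl' (b := b) ha
  have h2 := hy.abs_drift_le hl hl' (b := a) hb
  have h3 := hy.2 a b (Or.inl ha)
  have h4 := h a b
  rw [hs b a, add_comm b a] at h2
  rw [abs_le] at *
  constructor <;> linarith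

/-! ### Duality between the generator and the tail system -/

/-- The indicator of `a ≤ q`, as a real number. -/
noncomputable def geInd (a q : ℕ) : ℝ := if a ≤ q then 1 else 0

/-- The indicator that all queues are at least as long as `m` prescribes. -/
noncomputable def geIndProd {n : ℕ} (m q : Fin n → ℕ) : ℝ := ∏ v, geInd (m v) (q v)

open Classical in
/-- The indicator that all queues are at least as long as `m` prescribes and the matching is `M`. -/
noncomputable def tailInd {n : ℕ} (m : Fin n → ℕ) (M : PerfectMatching n) (s : State n) : ℝ :=
  if s.2 = M then geIndProd m s.1 else 0

/-- Twice the probability that a task offered to queues of lengths `x`, `y` joins the first. -/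
noncomputable def preference (x y : ℕ) : ℝ := if x < y then 2 else if x = y then 1 else 0

theorem geInd_of_le {a q : ℕ} (h : a ≤ q) : geInd a q = 1 := if_pos h

theorem geInd_of_lt {a q : ℕ} (h : q < a) : geInd a q = 0 := if_neg (not_le.2 h)

theorem geInd_max (a b q : ℕ) : geInd (max a b) q = geInd a q * geInd b q := by
  unfold geInd
  by_cases h1 : a ≤ q <;> by_cases h2 : b ≤ q <;> simp [h1, h2]

theorem geInd_nonneg (a q : ℕ) : 0 ≤ geInd a q := by unfold geInd; split_ifs <;> simp

theorem geInd_le_one (a q : ℕ) : geInd a q ≤ 1 := by unfold geInd; split_ifs <;> simp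

/-- The identity that closes the system: a joining task matters only when x = a - 1, and then
`preference x y` equals the sum of the indicators of y ≥ a and y ≥ a - 1. -/
theorem tailDrift_geInd (lam : ℝ) (a b x y : ℕ) :
    lam * (preference x y * ((geInd a (x + 1) - geInd a x) * geInd b y))
      + (geInd a (x - 1) - geInd a x) * geInd b y
      = tailDrift lam (fun i j => geInd i x * geInd j y) a b := by
  rcases a with _ | c
  · simp [tailDrift, geInd]
  simp only [tailDrift, Nat.add_one_ne_zero, if_false, Nat.add_sub_cancel, geInd_max]
  have e1 : geInd (c + 1) (x + 1) = geInd c x := by simp [geInd]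
  have e2 : geInd (c + 1) (x - 1) = geInd (c + 1 + 1) x := by
    unfold geInd; congr 1; apply propext; omega
  rw [e1, e2]
  have key : preference x y * (geInd c x - geInd (c + 1) x)
      = (geInd c x - geInd (c + 1) x) * (geInd (c + 1) y + geInd c y) := by
    rcases lt_trichotomy x c with h | rfl | h
    · rw [geInd_of_lt h, geInd_of_lt (by omega : x < c + 1)]; ring
    · rw [geInd_of_le le_rfl, geInd_of_lt (by omega : x < x + 1), preference]
      rcases lt_trichotomy x y with h | rfl | h
      · rw [if_pos h, geInd_of_le h, geInd_of_le h.le]; norm_num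
      · rw [geInd_of_le le_rfl, geInd_of_lt (by omega : x < x + 1)]; simp
      · rw [geInd_of_lt h, geInd_of_lt (by omega : y < x + 1), if_neg (by omega),
          if_neg (by omega)]; ring
    · rw [geInd_of_le h.le, geInd_of_le (by omega : c + 1 ≤ x)]; ring
  linear_combination lam * geInd b y * key

theorem tailDrift_mul_right (lam : ℝ) (F : ℕ → ℕ → ℝ) (c : ℝ) (a b : ℕ) :
    tailDrift lam (fun i j => F i j * c) a b = tailDrift lam F a b * c := by
  unfold tailDrift
  split_ifs <;> ring

theorem prod_eq_mul_mul {n : ℕ} (f : Fin n → ℝ) {v w : Fin n} (h : w ≠ v) :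
    ∏ x, f x = f v * f w * ∏ x ∈ (Finset.univ.erase v).erase w, f x := by
  have hw : w ∈ Finset.univ.erase v := by simp [h]
  rw [← Finset.mul_prod_erase _ _ (Finset.mem_univ v), ← Finset.mul_prod_erase _ _ hw, ← mul_assoc]

theorem geIndProd_update {n : ℕ} (m q : Fin n → ℕ) {v w : Fin n} (h : w ≠ v) (x : ℕ) :
    geIndProd m (Function.update q v x) = geInd (m v) x * geInd (m w) (q w)
      * ∏ u ∈ (Finset.univ.erase v).erase w, geInd (m u) (q u) := by
  rw [geIndProd, prod_eq_mul_mul _ h]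
  simp only [Function.update_self, Function.update_of_ne h]
  congr 1
  refine Finset.prod_congr rfl fun u hu => ?_
  simp only [Finset.mem_erase] at hu
  rw [Function.update_of_ne hu.2.1]

theorem geIndProd_setPair {n : ℕ} (m q : Fin n → ℕ) {v w : Fin n} (h : w ≠ v) (i j : ℕ) :
    geIndProd (setPair m v w i j) q = geInd i (q v) * geInd j (q w)
      * ∏ u ∈ (Finset.univ.erase v).erase w, geInd (m u) (q u) := by
  rw [geIndProd, prod_eq_mul_mul _ h]
  congr 1
  · simp [setPair, h.symm]
  · refine Finset.prod_congr rfl fun u hu => ?_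
    simp only [Finset.mem_erase] at hu
    simp [setPair, hu.1, hu.2.1]

theorem shortest_average {n : ℕ} (s : State n) (v : Fin n) (f : Fin n → ℝ) :
    ((shortest s v).card : ℝ)⁻¹ * ∑ u ∈ shortest s v, f u
      = 2⁻¹ * (preference (s.1 v) (s.1 (s.2.1 v)) * f v
        + preference (s.1 (s.2.1 v)) (s.1 v) * f (s.2.1 v)) := by
  have hne := s.2.2.2 v
  rcases lt_trichotomy (s.1 v) (s.1 (s.2.1 v)) with h | h | h
  · have : shortest s v = {v} := by
      ext u
      simp only [shortest, nbhd, Finset.mem_filter, Finset.mem_insert, Finset.mem_singleton,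
        forall_eq_or_imp, forall_eq]
      constructor
      · rintro ⟨rfl | rfl, h1, h2⟩
        · rfl
        · omega
      · rintro rfl; exact ⟨Or.inl rfl, le_rfl, h.le⟩
    simp [this, preference, h, not_lt.2 h.le, h.ne']
  · have : shortest s v = {v, s.2.1 v} := by
      ext u
      simp only [shortest, nbhd, Finset.mem_filter, Finset.mem_insert, Finset.mem_singleton,
        forall_eq_or_imp, forall_eq]
      constructor
      · exact fun h => h.1
      · rintro (rfl | rfl)
        · exact ⟨Or.inl rfl, le_rfl, h.le⟩
        · exact ⟨Or.inr rfl, h.ge, le_rfl⟩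
    rw [this, Finset.card_pair hne.symm, Finset.sum_pair hne.symm]
    simp [preference, h]
  · have : shortest s v = {s.2.1 v} := by
      ext u
      simp only [shortest, nbhd, Finset.mem_filter, Finset.mem_insert, Finset.mem_singleton,
        forall_eq_or_imp, forall_eq]
      constructor
      · rintro ⟨rfl | rfl, h1, h2⟩
        · omega
        · rfl
      · rintro rfl; exact ⟨Or.inr rfl, h.le, le_rfl⟩
    simp [this, preference, h, not_lt.2 h.le, h.ne']

/-- Tasks reach the queue at v from arrivals at v and at its partner; reindexing by the matching
merges both streams, which removes the factor 1/2. -/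
theorem sum_shortest_average {n : ℕ} (s : State n) (f : Fin n → ℝ) :
    ∑ v, ((shortest s v).card : ℝ)⁻¹ * ∑ u ∈ shortest s v, f u
      = ∑ v, preference (s.1 v) (s.1 (s.2.1 v)) * f v := by
  simp only [shortest_average]
  rw [← Finset.mul_sum, Finset.sum_add_distrib]
  have : ∑ v, preference (s.1 (s.2.1 v)) (s.1 v) * f (s.2.1 v)
      = ∑ v, preference (s.1 v) (s.1 (s.2.1 v)) * f v := by
    rw [← Equiv.sum_comp s.2.1 fun v => preference (s.1 v) (s.1 (s.2.1 v)) * f v]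
    simp only [s.2.2.1]
  rw [this]; ring

theorem swapMembership_swapMembership {n : ℕ} (u v : Fin n) (M : PerfectMatching n) :
    swapMembership u v (swapMembership u v M) = M := by
  apply Subtype.ext
  simp [swapMembership, mul_assoc]

theorem tailInd_swapMembership {n : ℕ} (m : Fin n → ℕ) (M : PerfectMatching n) (s : State n)
    (u v : Fin n) :
    tailInd m M (s.1, swapMembership u v s.2) = tailInd m (swapMembership u v M) s := by
  have : swapMembership u v s.2 = M ↔ s.2 = swapMembership u v M :=
    ⟨fun h => by rw [← h, swapMembership_swapMembership],
      fun h => by rw [h, swapMembership_swapMembership]⟩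
  classical
  unfold tailInd
  simp only
  by_cases h : s.2 = swapMembership u v M
  · rw [if_pos (this.2 h), if_pos h]
  · rw [if_neg (mt this.1 h), if_neg h]

theorem generator_tailInd (lam κ : ℝ) {n : ℕ} (m : Fin n → ℕ) (M : PerfectMatching n)
    (s : State n) : generator lam κ (tailInd m M) s
      = tailGenerator lam κ (fun m' M' => tailInd m' M' s) m M := by
  simp only [generator, tailGenerator, Finset.sum_add_distrib, ← Finset.mul_sum,
    tailInd_swapMembership, sum_shortest_average]
  congr 1
  rw [Finset.mul_sum, ← Finset.sum_add_distrib]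
  refine Finset.sum_congr rfl fun v _ => ?_
  obtain ⟨q, M'⟩ := s
  by_cases hM : M' = M
  · subst hM
    have hne := M'.2.2 v
    simp only [tailInd, addTask, serve, if_true, geIndProd_update m q hne, geIndProd_setPair m q hne,
      tailDrift_mul_right, ← tailDrift_geInd]
    rw [geIndProd, prod_eq_mul_mul _ hne]
    ring
  · simp [tailInd, addTask, serve, hM, tailDrift]

/-! ### Joint tails of a stationary distribution -/

/-- The joint tail function of a distribution on the states. -/
noncomputable def jointTail {n : ℕ} (μ : PMF (State n)) (m : Fin n → ℕ) (M : PerfectMatching n) :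
    ℝ := ∑' s, (μ s).toReal * tailInd m M s

theorem hasSum_toReal {α : Type*} (μ : PMF α) : HasSum (fun s => (μ s).toReal) 1 := by
  have h := ENNReal.hasSum_toReal (f := fun s => μ s) (by rw [μ.tsum_coe]; simp)
  rwa [← ENNReal.tsum_toReal_eq μ.apply_ne_top, μ.tsum_coe, ENNReal.toReal_one] at h

theorem summable_toReal_mul {α : Type*} (μ : PMF α) {f : α → ℝ} {C : ℝ} (hf : ∀ s, |f s| ≤ C) :
    Summable fun s => (μ s).toReal * f s := by
  refine Summable.of_norm_bounded ((hasSum_toReal μ).summable.mul_right C) fun s => ?_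
  rw [Real.norm_eq_abs, abs_mul, abs_of_nonneg ENNReal.toReal_nonneg]
  exact mul_le_mul_of_nonneg_left (hf s) ENNReal.toReal_nonneg

theorem geIndProd_nonneg {n : ℕ} (m q : Fin n → ℕ) : 0 ≤ geIndProd m q :=
  Finset.prod_nonneg fun _ _ => geInd_nonneg _ _

theorem geIndProd_le_one {n : ℕ} (m q : Fin n → ℕ) : geIndProd m q ≤ 1 :=
  Finset.prod_le_one (fun _ _ => geInd_nonneg _ _) fun _ _ => geInd_le_one _ _

theorem tailInd_nonneg {n : ℕ} (m : Fin n → ℕ) (M : PerfectMatching n) (s : State n) :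
    0 ≤ tailInd m M s := by
  unfold tailInd; split_ifs
  · exact geIndProd_nonneg _ _
  · exact le_rfl

theorem tailInd_le_one {n : ℕ} (m : Fin n → ℕ) (M : PerfectMatching n) (s : State n) :
    tailInd m M s ≤ 1 := by
  unfold tailInd; split_ifs
  · exact geIndProd_le_one _ _
  · exact zero_le_one

theorem abs_tailInd_le_one {n : ℕ} (m : Fin n → ℕ) (M : PerfectMatching n) (s : State n) :
    |tailInd m M s| ≤ 1 := abs_le.2 ⟨by linarith [tailInd_nonneg m M s], tailInd_le_one m M s⟩

theorem hasSum_jointTail {n : ℕ} (μ : PMF (State n)) (m : Fin n → ℕ) (M : PerfectMatching n) :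
    HasSum (fun s => (μ s).toReal * tailInd m M s) (jointTail μ m M) :=
  (summable_toReal_mul μ (abs_tailInd_le_one m M)).hasSum

theorem hasSum_tailDrift {α : Type*} (lam : ℝ) (p : α → ℝ) {f : ℕ → ℕ → α → ℝ} {F : ℕ → ℕ → ℝ}
    (h : ∀ i j, HasSum (fun s => p s * f i j s) (F i j)) (a b : ℕ) :
    HasSum (fun s => p s * tailDrift lam (fun i j => f i j s) a b) (tailDrift lam F a b) := by
  unfold tailDrift
  split_ifs with ha
  · simp
  · refine (((h (a + 1) b).sub (h a b)).add (((((h (a - 1) (max a b)).add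
      (h (a - 1) (max (a - 1) b))).sub (h a (max a b))).sub
      (h a (max (a - 1) b))).mul_left lam)).congr_fun ?_
    intro s; ring

theorem IsStationary.tailGenerator_jointTail {lam κ : ℝ} {n : ℕ} {μ : PMF (State n)}
    (hμ : IsStationary lam κ μ) (m : Fin n → ℕ) (M : PerfectMatching n) :
    tailGenerator lam κ (jointTail μ) m M = 0 := by
  have H : HasSum (fun s => (μ s).toReal * generator lam κ (tailInd m M) s)
      (tailGenerator lam κ (jointTail μ) m M) := by
    simp only [generator_tailInd, tailGenerator, mul_add]
    refine HasSum.add ?_ ?_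
    · simp only [Finset.mul_sum]
      exact hasSum_sum fun v _ => hasSum_tailDrift lam _ (fun i j => hasSum_jointTail μ _ M) _ _
    · have : HasSum (fun s => ∑ v : Fin n, ∑ u : Fin n, ((μ s).toReal *
          tailInd m (swapMembership v u M) s - (μ s).toReal * tailInd m M s))
          (∑ v : Fin n, ∑ u : Fin n,
            (jointTail μ m (swapMembership v u M) - jointTail μ m M)) :=
        hasSum_sum fun v _ => hasSum_sum fun u _ =>
          (hasSum_jointTail μ _ _).sub (hasSum_jointTail μ _ _)
      refine ((this.mul_left _).mul_left κ).congr_fun ?_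
      intro s
      simp only [← mul_sub, ← Finset.mul_sum]
      ring
  rw [← H.tsum_eq]
  exact hμ (tailInd m M) ⟨1, abs_tailInd_le_one m M⟩

/-! ### Linearity and positivity of the generator -/

theorem generator_add (lam κ : ℝ) {n : ℕ} (f g : State n → ℝ) :
    generator lam κ (f + g) = generator lam κ f + generator lam κ g := by
  ext s
  simp only [generator, Pi.add_apply, ← Finset.sum_add_distrib]
  refine Finset.sum_congr rfl fun v _ => ?_
  simp only [add_sub_add_comm, Finset.sum_add_distrib]
  ring

theorem generator_smul (lam κ : ℝ) {n : ℕ} (c : ℝ) (f : State n → ℝ) :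
    generator lam κ (c • f) = c • generator lam κ f := by
  ext s
  simp only [generator, Pi.smul_apply, smul_eq_mul, Finset.mul_sum]
  refine Finset.sum_congr rfl fun v _ => ?_
  simp only [← mul_sub, ← Finset.mul_sum]
  ring

/-- The generator as a linear map. -/
noncomputable def generatorHom (lam κ : ℝ) (n : ℕ) : (State n → ℝ) →ₗ[ℝ] (State n → ℝ) where
  toFun := generator lam κ
  map_add' := generator_add lam κ
  map_smul' := generator_smul lam κ

theorem generator_const (lam κ : ℝ) {n : ℕ} (c : ℝ) :
    generator lam κ (fun _ : State n => c) = 0 := by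
  ext s; simp [generator]

theorem neg_le_card_inv_mul_sum {α : Type*} (S : Finset α) (a : α → ℝ) {x : ℝ} (hx : 0 ≤ x)
    (h : ∀ u ∈ S, -x ≤ a u) : -x ≤ (S.card : ℝ)⁻¹ * ∑ u ∈ S, a u := by
  rcases S.eq_empty_or_nonempty with rfl | hS
  · simpa using hx
  · have : (0 : ℝ) < S.card := by exact_mod_cast hS.card_pos
    rw [inv_mul_eq_div, le_div_iff₀ this]
    have := Finset.card_nsmul_le_sum S a (-x) h
    rw [nsmul_eq_mul] at this
    linarith

/-- The total jump rate. -/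
noncomputable def totalRate (lam κ : ℝ) (n : ℕ) : ℝ := n * (lam + 1 + κ)

theorem totalRate_nonneg {lam κ : ℝ} (hl : 0 ≤ lam) (hκ : 0 ≤ κ) (n : ℕ) :
    0 ≤ totalRate lam κ n := by unfold totalRate; positivity

/-- For a nonnegative function only the loss from leaving s is negative. Hence the generator plus
`totalRate` times the identity preserves order, which replaces any appeal to a semigroup. -/
theorem neg_totalRate_mul_le_generator {lam κ : ℝ} (hl : 0 ≤ lam) (hκ : 0 ≤ κ) {n : ℕ}
    {h : State n → ℝ} (hh : ∀ s, 0 ≤ h s) (s : State n) :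
    -(totalRate lam κ n * h s) ≤ generator lam κ h s := by
  have e : -(totalRate lam κ n * h s) = ∑ _v : Fin n, (lam * -h s + -h s + κ * -h s) := by
    simp [totalRate]; ring
  rw [e, generator]
  refine Finset.sum_le_sum fun v _ => ?_
  gcongr ?_ + ?_ + ?_
  · exact mul_le_mul_of_nonneg_left (neg_le_card_inv_mul_sum _ _ (hh s)
      fun u _ => by linarith [hh (addTask s u)]) hl
  · linarith [hh (serve s v)]
  · refine mul_le_mul_of_nonneg_left ?_ hκ
    have := neg_le_card_inv_mul_sum (Finset.univ : Finset (Fin n))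
      (fun u => h (s.1, swapMembership v u s.2) - h s) (hh s)
      fun u _ => by linarith [hh (s.1, swapMembership v u s.2)]
    simpa using this

theorem generator_add_totalRate_mono {lam κ : ℝ} (hl : 0 ≤ lam) (hκ : 0 ≤ κ) {n : ℕ}
    {f g : State n → ℝ} (hfg : ∀ s, f s ≤ g s) (s : State n) :
    generator lam κ f s + totalRate lam κ n * f s
      ≤ generator lam κ g s + totalRate lam κ n * g s := by
  have h1 := neg_totalRate_mul_le_generator hl hκ (h := g + (-1 : ℝ) • f)
    (fun s => by simpa using hfg s) s
  rw [generator_add, generator_smul] at h1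
  simp only [Pi.add_apply, Pi.smul_apply, smul_eq_mul] at h1
  linarith

theorem abs_generator_le {lam κ : ℝ} (hl : 0 ≤ lam) (hκ : 0 ≤ κ) {n : ℕ} {f : State n → ℝ} {C : ℝ}
    (hf : ∀ s, |f s| ≤ C) (s : State n) :
    |generator lam κ f s| ≤ 2 * totalRate lam κ n * C := by
  have h1 := generator_add_totalRate_mono hl hκ (g := fun _ => C) (fun s => (abs_le.1 (hf s)).2) s
  have h2 := generator_add_totalRate_mono hl hκ (f := fun _ => -C) (fun s => (abs_le.1 (hf s)).1) s
  rw [generator_const] at h1 h2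
  simp only [Pi.zero_apply] at h1 h2
  have h3 := mul_le_mul_of_nonneg_left (abs_le.1 (hf s)).1 (totalRate_nonneg hl hκ n)
  have h4 := mul_le_mul_of_nonneg_left (abs_le.1 (hf s)).2 (totalRate_nonneg hl hκ n)
  rw [abs_le]
  constructor <;> linarith

/-! ### Lyapunov function and exponential moments -/

/-- A Lyapunov function of the model. -/
noncomputable def lyapunov {n : ℕ} (s : State n) : ℝ := ∏ v, (8 * (n : ℝ) + 2 ^ s.1 v)

theorem two_pow_sum_le_lyapunov {n : ℕ} (s : State n) : 2 ^ (∑ v, s.1 v) ≤ lyapunov s := by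
  rw [lyapunov, ← Finset.prod_pow_eq_pow_sum]
  exact Finset.prod_le_prod (fun _ _ => by positivity) fun _ _ => by
    linarith [(Nat.cast_nonneg n : (0 : ℝ) ≤ n)]

theorem lyapunov_pos {n : ℕ} (s : State n) : 0 < lyapunov s :=
  lt_of_lt_of_le (by positivity) (two_pow_sum_le_lyapunov s)

theorem finite_lyapunov_le (n : ℕ) (c : ℝ) : {s : State n | lyapunov s ≤ c}.Finite := by
  refine ((Set.finite_Iic (fun _ : Fin n => ⌊c⌋₊)).prod Set.finite_univ).subset fun s hs => ?_
  refine ⟨fun v => Nat.le_floor ?_, trivial⟩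
  refine le_trans ?_ ((two_pow_sum_le_lyapunov s).trans hs)
  have h1 : s.1 v ≤ ∑ v, s.1 v := Finset.single_le_sum (fun _ _ => Nat.zero_le _) (Finset.mem_univ v)
  have h2 : s.1 v < 2 ^ (∑ v, s.1 v) := h1.trans_lt Nat.lt_two_pow_self
  exact_mod_cast h2.le

/-- The relative increase of the Lyapunov function when a task joins a queue of length `q`. -/
noncomputable def relIncrease (n q : ℕ) : ℝ := 2 ^ q / (8 * (n : ℝ) + 2 ^ q)

theorem relIncrease_mono (n : ℕ) : Monotone (relIncrease n) := by
  intro a b hab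
  unfold relIncrease
  rw [div_le_div_iff₀ (by positivity) (by positivity)]
  have : (2 : ℝ) ^ a ≤ 2 ^ b := pow_le_pow_right₀ (by norm_num) hab
  nlinarith [mul_le_mul_of_nonneg_left this (by positivity : 0 ≤ 8 * (n : ℝ))]

theorem relIncrease_nonneg (n q : ℕ) : 0 ≤ relIncrease n q := by unfold relIncrease; positivity

theorem lyapunov_update {n : ℕ} (s : State n) (v : Fin n) (x : ℕ) :
    lyapunov (Function.update s.1 v x, s.2) - lyapunov s
      = lyapunov s * ((2 ^ x - 2 ^ s.1 v) / (8 * (n : ℝ) + 2 ^ s.1 v)) := by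
  have h : (8 * (n : ℝ) + 2 ^ s.1 v) ≠ 0 := by positivity
  simp only [lyapunov]
  rw [← Finset.mul_prod_erase _ _ (Finset.mem_univ v),
    ← Finset.mul_prod_erase _ (fun w => 8 * (n : ℝ) + 2 ^ s.1 w) (Finset.mem_univ v)]
  have : ∏ w ∈ Finset.univ.erase v, (8 * (n : ℝ) + 2 ^ Function.update s.1 v x w)
      = ∏ w ∈ Finset.univ.erase v, (8 * (n : ℝ) + 2 ^ s.1 w) :=
    Finset.prod_congr rfl fun w hw => by rw [Function.update_of_ne (Finset.ne_of_mem_erase hw)]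
  simp only [Function.update_self, this]
  field_simp
  ring

theorem lyapunov_addTask {n : ℕ} (s : State n) (v : Fin n) :
    lyapunov (addTask s v) - lyapunov s = lyapunov s * relIncrease n (s.1 v) := by
  rw [addTask, lyapunov_update, relIncrease, pow_succ]
  congr 2; ring

theorem lyapunov_serve_le {n : ℕ} (s : State n) (v : Fin n) :
    lyapunov (serve s v) - lyapunov s
      ≤ lyapunov s * (relIncrease n 0 / 2 - relIncrease n (s.1 v) / 2) := by
  rw [serve, lyapunov_update]
  refine mul_le_mul_of_nonneg_left ?_ (lyapunov_pos s).le
  have h0 := relIncrease_nonneg n 0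
  rcases h : s.1 v with _ | q
  · simp
  · have : ((2 : ℝ) ^ (q + 1 - 1) - 2 ^ (q + 1)) / (8 * (n : ℝ) + 2 ^ (q + 1))
        = - (relIncrease n (q + 1) / 2) := by
      rw [relIncrease, Nat.add_sub_cancel, pow_succ]; ring
    rw [this]; linarith

/-- Joining the shortest queue is no worse than joining the queue at the arrival vertex, so services
outweigh arrivals vertex by vertex. The offset 8n keeps the total correction for empty servers at
1/16. One queue with 2^q ≥ 8n then makes the drift negative, and without such a queue the function
is at most (16n)^n. -/
theorem generator_lyapunov_le {lam : ℝ} (hl : 0 ≤ lam) (hl' : lam ≤ 1 / 4) (κ : ℝ) {n : ℕ}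
    (hn : 0 < n) (s : State n) :
    generator lam κ lyapunov s ≤ (16 * n) ^ n / 8 - lyapunov s / 16 := by
  have hn' : (1 : ℝ) ≤ n := by exact_mod_cast hn
  have hV := lyapunov_pos s
  set φ : Fin n → ℝ := fun v => relIncrease n (s.1 v) with hφ
  have havg : ∀ v, ((shortest s v).card : ℝ)⁻¹ * ∑ u ∈ shortest s v, φ u ≤ φ v := by
    intro v
    rw [shortest_average]
    simp only [hφ, preference]
    rcases lt_trichotomy (s.1 v) (s.1 (s.2.1 v)) with h | h | h
    · simp [h, not_lt.2 h.le, h.ne']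
    · simp only [h, lt_irrefl, if_true, if_false]; linarith
    · simpa [h, not_lt.2 h.le, h.ne'] using relIncrease_mono n h.le
  have h1 : generator lam κ lyapunov s ≤ ∑ v, lyapunov s * (1 / (16 * n) - φ v / 4) := by
    unfold generator
    refine Finset.sum_le_sum fun v _ => ?_
    have e1 : ∀ u, lyapunov (s.1, swapMembership v u s.2) - lyapunov s = 0 := by
      intro u; simp [lyapunov]
    simp only [e1, Finset.sum_const_zero, mul_zero, add_zero, lyapunov_addTask, ← Finset.mul_sum]
    have e2 := lyapunov_serve_le s v
    have e3 : relIncrease n 0 ≤ 1 / (8 * n) := by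
      rw [relIncrease, pow_zero]; gcongr; linarith
    have e4 : lam * (((shortest s v).card : ℝ)⁻¹ * (lyapunov s * ∑ u ∈ shortest s v, φ u))
        ≤ lyapunov s * (1 / 4 * φ v) := by
      have : lam * (((shortest s v).card : ℝ)⁻¹ * ∑ u ∈ shortest s v, φ u) ≤ 1 / 4 * φ v :=
        (mul_le_mul_of_nonneg_left (havg v) hl).trans
          (mul_le_mul_of_nonneg_right hl' (relIncrease_nonneg _ _))
      calc _ = lyapunov s * (lam * (((shortest s v).card : ℝ)⁻¹ * ∑ u ∈ shortest s v, φ u)) := by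
            ring
        _ ≤ _ := mul_le_mul_of_nonneg_left this hV.le
    have e5 : lyapunov s * relIncrease n 0 ≤ lyapunov s * (1 / (8 * n)) :=
      mul_le_mul_of_nonneg_left e3 hV.le
    have e6 : (1 : ℝ) / (16 * n) = 1 / (8 * n) / 2 := by field_simp; norm_num
    rw [e6]
    simp only [← hφ] at *
    linarith
  have h2 : ∑ v, lyapunov s * (1 / (16 * n) - φ v / 4)
      = lyapunov s * (1 / 16 - (∑ v, φ v) / 4) := by
    rw [← Finset.mul_sum, Finset.sum_sub_distrib, Finset.sum_div]
    simp only [Finset.sum_const, Finset.card_univ, Fintype.card_fin, nsmul_eq_mul]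
    congr 2
    field_simp
  rw [h2] at h1
  refine h1.trans ?_
  have hs0 : 0 ≤ ∑ v, φ v := Finset.sum_nonneg fun _ _ => relIncrease_nonneg _ _
  by_cases hb : ∃ v, 8 * (n : ℝ) ≤ 2 ^ s.1 v
  · obtain ⟨v, hv⟩ := hb
    have h3 : 1 / 2 ≤ φ v := by
      simp only [hφ, relIncrease]
      rw [div_le_div_iff₀ (by norm_num) (by positivity)]
      linarith
    have h4 : φ v ≤ ∑ v, φ v :=
      Finset.single_le_sum (fun _ _ => relIncrease_nonneg _ _) (Finset.mem_univ v)
    have h5 : lyapunov s * (1 / 16 - (∑ v, φ v) / 4) ≤ lyapunov s * (-(1 / 16)) :=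
      mul_le_mul_of_nonneg_left (by linarith) hV.le
    have : (0 : ℝ) ≤ (16 * n) ^ n / 8 := by positivity
    linarith
  · push Not at hb
    have h3 : lyapunov s ≤ (16 * n) ^ n := by
      calc lyapunov s ≤ ∏ _v : Fin n, (16 * (n : ℝ)) :=
            Finset.prod_le_prod (fun _ _ => by positivity) fun v _ => by linarith [hb v]
        _ = _ := by simp
    have h5 : lyapunov s * (1 / 16 - (∑ v, φ v) / 4) ≤ lyapunov s * (1 / 16) :=
      mul_le_mul_of_nonneg_left (by linarith) hV.le
    linarith

theorem sum_toReal_mul_lyapunov_le {lam κ : ℝ} (hl : 0 ≤ lam) (hl' : lam ≤ 1 / 4) (hκ : 0 ≤ κ)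
    {n : ℕ} (hn : 0 < n) {μ : PMF (State n)} (hμ : IsStationary lam κ μ)
    (S : Finset (State n)) : ∑ s ∈ S, (μ s).toReal * lyapunov s ≤ 2 * (16 * n) ^ n := by
  obtain ⟨K, hK0, hK⟩ : ∃ K : ℝ, 0 ≤ K ∧ ∀ s ∈ S, lyapunov s ≤ K :=
    ⟨∑ s ∈ S, lyapunov s, Finset.sum_nonneg fun s _ => (lyapunov_pos s).le,
      fun s hs => Finset.single_le_sum (fun s _ => (lyapunov_pos s).le) hs⟩
  set C : ℝ := (16 * n) ^ n / 8 with hC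
  have hC0 : 0 ≤ C := by positivity
  -- Stationarity tests only bounded functions, so the Lyapunov function is truncated at a level K
  -- that is not exceeded on S.
  set f : State n → ℝ := fun s => min (lyapunov s) K
  have hf : ∀ s, |f s| ≤ K := fun s =>
    abs_le.2 ⟨by linarith [le_min (lyapunov_pos s).le hK0], min_le_right _ _⟩
  set W : State n → ℝ := fun s => if lyapunov s ≤ K then lyapunov s else 0 with hW
  have hWb : ∀ s, |W s| ≤ K := by
    intro s
    simp only [hW]
    split_ifs with h
    · rwa [abs_of_pos (lyapunov_pos s)]
    · simpa using hK0
  have hW0 : ∀ s, 0 ≤ W s := by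
    intro s
    simp only [hW]
    split_ifs with h
    · exact (lyapunov_pos s).le
    · exact le_rfl
  have hgen : ∀ s, generator lam κ f s ≤ C - W s / 16 := by
    intro s
    simp only [hW]
    split_ifs with h
    · refine le_trans ?_ (generator_lyapunov_le hl hl' κ hn s)
      have h1 := generator_add_totalRate_mono hl hκ (f := f) (g := lyapunov)
        (fun s => min_le_left _ _) s
      have : f s = lyapunov s := min_eq_left h
      rw [this] at h1
      linarith
    · have h1 := generator_add_totalRate_mono hl hκ (f := f) (g := fun _ => K)
        (fun s => min_le_right _ _) s
      have : f s = K := min_eq_right (not_le.1 h).le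
      rw [this, generator_const] at h1
      simp only [Pi.zero_apply] at h1
      linarith
  have s1 := summable_toReal_mul μ (abs_generator_le hl hκ hf)
  have s2 := summable_toReal_mul μ hWb
  have s3 : HasSum (fun s => (μ s).toReal * (C - W s / 16))
      (1 * C - (∑' s, (μ s).toReal * W s) / 16) :=
    (((hasSum_toReal μ).mul_right C).sub (s2.hasSum.div_const 16)).congr_fun fun s => by ring
  have h1 : 0 ≤ 1 * C - (∑' s, (μ s).toReal * W s) / 16 := by
    rw [← hμ f ⟨K, hf⟩, ← s3.tsum_eq]
    exact s1.tsum_le_tsum (fun s => mul_le_mul_of_nonneg_left (hgen s) ENNReal.toReal_nonneg)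
      s3.summable
  have h2 : ∑ s ∈ S, (μ s).toReal * lyapunov s = ∑ s ∈ S, (μ s).toReal * W s :=
    Finset.sum_congr rfl fun s hs => by simp only [hW, if_pos (hK s hs)]
  rw [h2]
  have h3 := s2.sum_le_tsum S fun s _ => mul_nonneg ENNReal.toReal_nonneg (hW0 s)
  rw [hC] at h1
  linarith

theorem tailInd_le_lyapunov {n : ℕ} (m : Fin n → ℕ) (M : PerfectMatching n) (s : State n) :
    tailInd m M s ≤ lyapunov s * (1 / 2) ^ (∑ v, m v) := by
  have hp : (0 : ℝ) < (1 / 2) ^ (∑ v, m v) := by positivity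
  by_cases h : ∀ v, m v ≤ s.1 v
  · refine (tailInd_le_one m M s).trans ?_
    rw [one_div, inv_pow, ← div_eq_mul_inv, le_div_iff₀ (by positivity), one_mul]
    refine le_trans ?_ (two_pow_sum_le_lyapunov s)
    exact pow_le_pow_right₀ (by norm_num) (Finset.sum_le_sum fun v _ => h v)
  · push Not at h
    obtain ⟨v, hv⟩ := h
    have : tailInd m M s = 0 := by
      unfold tailInd
      split_ifs
      · exact Finset.prod_eq_zero (Finset.mem_univ v) (geInd_of_lt hv)
      · rfl
    rw [this]
    exact mul_nonneg (lyapunov_pos s).le hp.le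

/-- Markov's inequality for the Lyapunov function. The constant is huge in n, but only its
finiteness is needed to apply the stability estimate. -/
theorem IsStationary.jointTail_le {lam κ : ℝ} (hl : 0 ≤ lam) (hl' : lam ≤ 1 / 4) (hκ : 0 ≤ κ)
    {n : ℕ} (hn : 0 < n) {μ : PMF (State n)} (hμ : IsStationary lam κ μ) (m : Fin n → ℕ)
    (M : PerfectMatching n) : jointTail μ m M ≤ 2 * (16 * n) ^ n * (1 / 2) ^ (∑ v, m v) := by
  refine Real.tsum_le_of_sum_le (fun s => mul_nonneg ENNReal.toReal_nonneg (tailInd_nonneg m M s))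
    fun S => ?_
  calc ∑ s ∈ S, (μ s).toReal * tailInd m M s
      ≤ ∑ s ∈ S, (μ s).toReal * lyapunov s * (1 / 2) ^ (∑ v, m v) := by
        refine Finset.sum_le_sum fun s _ => ?_
        rw [mul_assoc]
        exact mul_le_mul_of_nonneg_left (tailInd_le_lyapunov m M s) ENNReal.toReal_nonneg
    _ = (∑ s ∈ S, (μ s).toReal * lyapunov s) * (1 / 2) ^ (∑ v, m v) := by rw [Finset.sum_mul]
    _ ≤ _ := mul_le_mul_of_nonneg_right (sum_toReal_mul_lyapunov_le hl hl' hκ hn hμ S)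
        (by positivity)

theorem jointTail_nonneg {n : ℕ} (μ : PMF (State n)) (m : Fin n → ℕ) (M : PerfectMatching n) :
    0 ≤ jointTail μ m M :=
  tsum_nonneg fun s => mul_nonneg ENNReal.toReal_nonneg (tailInd_nonneg m M s)

/-! ### Existence of a stationary distribution -/

/-- One step of the uniformized chain. -/
noncomputable def uniformized (lam κ : ℝ) (n : ℕ) : (State n → ℝ) →ₗ[ℝ] (State n → ℝ) :=
  LinearMap.id + (totalRate lam κ n + 1)⁻¹ • generatorHom lam κ n

theorem uniformized_apply (lam κ : ℝ) {n : ℕ} (f : State n → ℝ) (s : State n) :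
    uniformized lam κ n f s = f s + (totalRate lam κ n + 1)⁻¹ * generator lam κ f s := rfl

theorem uniformized_mono {lam κ : ℝ} (hl : 0 ≤ lam) (hκ : 0 ≤ κ) {n : ℕ} :
    Monotone (uniformized lam κ n) := by
  intro f g hfg s
  have hr := totalRate_nonneg hl hκ n
  have h := generator_add_totalRate_mono hl hκ hfg s
  have h0 := hfg s
  rw [uniformized_apply, uniformized_apply]
  have e : ∀ x y : ℝ, x + (totalRate lam κ n + 1)⁻¹ * y
      = (totalRate lam κ n + 1)⁻¹ * (y + totalRate lam κ n * x + x) := by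
    intro x y; field_simp; ring
  rw [e, e]
  exact mul_le_mul_of_nonneg_left (by linarith) (by positivity)

/-- The mean of `f` over the first `N + 1` steps of the uniformized chain started at `s₀`. -/
noncomputable def cesaro (lam κ : ℝ) {n : ℕ} (s₀ : State n) (N : ℕ) : (State n → ℝ) →ₗ[ℝ] ℝ :=
  ((N : ℝ) + 1)⁻¹ • ∑ k ∈ Finset.range (N + 1), LinearMap.proj s₀ ∘ₗ (uniformized lam κ n ^ k)

theorem cesaro_apply (lam κ : ℝ) {n : ℕ} (s₀ : State n) (N : ℕ) (f : State n → ℝ) :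
    cesaro lam κ s₀ N f
      = ((N : ℝ) + 1)⁻¹ * ∑ k ∈ Finset.range (N + 1), (uniformized lam κ n ^ k) f s₀ := by
  simp [cesaro]

theorem uniformized_pow_mono {lam κ : ℝ} (hl : 0 ≤ lam) (hκ : 0 ≤ κ) {n : ℕ} (k : ℕ) :
    Monotone (uniformized lam κ n ^ k) := by
  rw [Module.End.coe_pow]
  exact (uniformized_mono hl hκ).iterate k

theorem cesaro_mono {lam κ : ℝ} (hl : 0 ≤ lam) (hκ : 0 ≤ κ) {n : ℕ} (s₀ : State n) (N : ℕ) :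
    Monotone (cesaro lam κ s₀ N) := by
  intro f g hfg
  rw [cesaro_apply, cesaro_apply]
  refine mul_le_mul_of_nonneg_left ?_ (by positivity)
  exact Finset.sum_le_sum fun k _ => uniformized_pow_mono hl hκ k hfg s₀

theorem uniformized_pow_const (lam κ : ℝ) {n : ℕ} (k : ℕ) (c : ℝ) :
    (uniformized lam κ n ^ k) (fun _ => c) = fun _ => c := by
  rw [Module.End.coe_pow]
  refine Function.iterate_fixed ?_ k
  ext s
  rw [uniformized_apply, generator_const]
  simp

theorem cesaro_le_of_uniformized_pow_le {lam κ : ℝ} {n : ℕ} {s₀ : State n} {f : State n → ℝ}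
    {c : ℝ} (h : ∀ k, (uniformized lam κ n ^ k) f s₀ ≤ c) (N : ℕ) : cesaro lam κ s₀ N f ≤ c := by
  rw [cesaro_apply, inv_mul_le_iff₀ (by positivity)]
  have := Finset.sum_le_card_nsmul (Finset.range (N + 1))
    (fun k => (uniformized lam κ n ^ k) f s₀) c fun k _ => h k
  simpa using this

theorem cesaro_const (lam κ : ℝ) {n : ℕ} (s₀ : State n) (N : ℕ) (c : ℝ) :
    cesaro lam κ s₀ N (fun _ => c) = c := by
  rw [cesaro_apply]
  simp only [uniformized_pow_const, Finset.sum_const, Finset.card_range, nsmul_eq_mul]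
  push_cast
  field_simp

theorem abs_uniformized_pow_le {lam κ : ℝ} (hl : 0 ≤ lam) (hκ : 0 ≤ κ) {n : ℕ} {f : State n → ℝ}
    {C : ℝ} (hf : ∀ s, |f s| ≤ C) (k : ℕ) (s : State n) :
    |(uniformized lam κ n ^ k) f s| ≤ C := by
  have h1 := uniformized_pow_mono hl hκ k (show f ≤ fun _ => C from fun s => (abs_le.1 (hf s)).2) s
  have h2 := uniformized_pow_mono hl hκ k (show (fun _ => -C) ≤ f from fun s => (abs_le.1 (hf s)).1) s
  rw [uniformized_pow_const] at h1 h2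
  exact abs_le.2 ⟨h2, h1⟩

theorem abs_cesaro_le {lam κ : ℝ} (hl : 0 ≤ lam) (hκ : 0 ≤ κ) {n : ℕ} (s₀ : State n) {f : State n → ℝ}
    {C : ℝ} (hf : ∀ s, |f s| ≤ C) (N : ℕ) : |cesaro lam κ s₀ N f| ≤ C := by
  have h1 := cesaro_mono hl hκ s₀ N (show f ≤ fun _ => C from fun s => (abs_le.1 (hf s)).2)
  have h2 := cesaro_mono hl hκ s₀ N (show (fun _ => -C) ≤ f from fun s => (abs_le.1 (hf s)).1)
  rw [cesaro_const] at h1 h2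
  exact abs_le.2 ⟨h2, h1⟩

/-- The generator is a multiple of the uniformized step minus the identity, so the average
telescopes. -/
theorem abs_cesaro_generator_le {lam κ : ℝ} (hl : 0 ≤ lam) (hκ : 0 ≤ κ) {n : ℕ} (s₀ : State n)
    {f : State n → ℝ} {C : ℝ} (hf : ∀ s, |f s| ≤ C) (N : ℕ) :
    |cesaro lam κ s₀ N (generator lam κ f)|
      ≤ (totalRate lam κ n + 1) * (2 * C) * ((N : ℝ) + 1)⁻¹ := by
  have hr := totalRate_nonneg hl hκ n
  have e : generator lam κ f
      = (totalRate lam κ n + 1) • (uniformized lam κ n f - f) := by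
    ext s
    simp only [Pi.smul_apply, Pi.sub_apply, uniformized_apply, smul_eq_mul]
    field_simp; ring
  have e2 : ∀ k, (uniformized lam κ n ^ k) (generator lam κ f) s₀ = (totalRate lam κ n + 1) *
      ((uniformized lam κ n ^ (k + 1)) f s₀ - (uniformized lam κ n ^ k) f s₀) := by
    intro k
    rw [e, map_smul, map_sub, pow_succ]
    rfl
  rw [cesaro_apply]
  simp only [e2]
  rw [← Finset.mul_sum, Finset.sum_range_sub (fun k => (uniformized lam κ n ^ k) f s₀), abs_mul,
    abs_mul, abs_of_pos (by positivity : 0 < ((N : ℝ) + 1)⁻¹),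
    abs_of_pos (by positivity : 0 < totalRate lam κ n + 1), mul_comm]
  gcongr
  refine (abs_sub _ _).trans ?_
  linarith [abs_uniformized_pow_le hl hκ hf (N + 1) s₀, abs_uniformized_pow_le hl hκ hf 0 s₀]

/-- The drift inequality says that one step sends V to at most (1 - t) V + t K, and iterating such
convex combinations never exceeds V + K. -/
theorem uniformized_pow_lyapunov_le {lam κ : ℝ} (hl : 0 ≤ lam) (hl' : lam ≤ 1 / 4) (hκ : 0 ≤ κ)
    {n : ℕ} (hn : 0 < n) (s₀ : State n) (k : ℕ) :
    (uniformized lam κ n ^ k) lyapunov s₀ ≤ lyapunov s₀ + 2 * (16 * n) ^ n := by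
  set K : ℝ := 2 * (16 * n) ^ n with hK
  have hr := totalRate_nonneg hl hκ n
  suffices h : ∀ k s, (uniformized lam κ n ^ k) lyapunov s ≤ lyapunov s + K from h k s₀
  have hK0 : 0 ≤ K := by positivity
  set t : ℝ := (totalRate lam κ n + 1)⁻¹ / 16 with ht
  have hn1 : (1 : ℝ) ≤ n := by exact_mod_cast hn
  have ht0 : 0 ≤ t := by positivity
  have ht1 : t ≤ 1 := by
    have : (totalRate lam κ n + 1)⁻¹ ≤ 1 := inv_le_one_of_one_le₀ (by linarith)
    rw [ht]; linarith
  have hstep : uniformized lam κ n lyapunov ≤ (1 - t) • lyapunov + fun _ => t * K := by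
    intro s
    have h1 := generator_lyapunov_le hl hl' κ hn s
    have h2 := mul_le_mul_of_nonneg_left h1 (by positivity : 0 ≤ (totalRate lam κ n + 1)⁻¹)
    rw [uniformized_apply]
    simp only [Pi.add_apply, Pi.smul_apply, smul_eq_mul, ht, hK]
    linarith
  have main : ∀ k, (uniformized lam κ n ^ k) lyapunov ≤ lyapunov + fun _ => K := by
    intro k
    have h1 : ∀ k, (uniformized lam κ n ^ k) lyapunov
        ≤ (1 - t) ^ k • lyapunov + fun _ => (1 - (1 - t) ^ k) * K := by
      intro k
      induction k with
      | zero => intro s; simp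
      | succ k ih =>
        rw [pow_succ']
        refine (uniformized_mono hl hκ ih).trans ?_
        have e1 : uniformized lam κ n (fun _ => (1 - (1 - t) ^ k) * K)
            = fun _ => (1 - (1 - t) ^ k) * K := by
          simpa using uniformized_pow_const lam κ (n := n) 1 ((1 - (1 - t) ^ k) * K)
        rw [map_add, map_smul, e1]
        intro s
        have h2 := mul_le_mul_of_nonneg_left (hstep s) (pow_nonneg (by linarith : 0 ≤ 1 - t) k)
        simp only [Pi.add_apply, Pi.smul_apply, smul_eq_mul] at h2 ⊢
        rw [pow_succ]
        linarith
    intro s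
    have h2 := h1 k s
    simp only [Pi.add_apply, Pi.smul_apply, smul_eq_mul] at h2 ⊢
    have h3 : (1 - t) ^ k ≤ 1 := pow_le_one₀ (by linarith) (by linarith)
    have h4 : 0 ≤ (1 - t) ^ k := pow_nonneg (by linarith) k
    nlinarith [(lyapunov_pos s).le]
  exact fun k s => main k s

/-- Krylov–Bogolyubov with an ultrafilter: the limit of the Cesàro means is a positive functional
that annihilates the generator, and the Lyapunov bound makes it tight, hence given by a probability
mass function. -/
theorem exists_isStationary {lam κ : ℝ} (hl : 0 ≤ lam) (hl' : lam ≤ 1 / 4) (hκ : 0 ≤ κ)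
    {n : ℕ} (hn : 0 < n) (s₀ : State n) : ∃ μ : PMF (State n), IsStationary lam κ μ := by
  classical
  set U : Filter ℕ := (Filter.hyperfilter ℕ : Filter ℕ) with hU
  have hUt : U ≤ Filter.atTop := Nat.hyperfilter_le_atTop
  have hlim : ∀ f : State n → ℝ, (∃ C, ∀ s, |f s| ≤ C) →
      ∃ l, Filter.Tendsto (fun N => cesaro lam κ s₀ N f) U (nhds l) := by
    rintro f ⟨C, hC⟩
    obtain ⟨l, -, hl⟩ := (isCompact_Icc (a := -C) (b := C)).ultrafilter_le_nhds
      ((Filter.hyperfilter ℕ).map fun N => cesaro lam κ s₀ N f) (by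
        rw [Filter.le_principal_iff, Ultrafilter.coe_map, Filter.mem_map]
        exact Filter.univ_mem' fun N => abs_le.1 (abs_cesaro_le hl hκ s₀ hC N))
    exact ⟨l, hl⟩
  choose! φ hφ using hlim
  have hind : ∀ t : State n, ∃ C, ∀ s, |(Pi.single t 1 : State n → ℝ) s| ≤ C := fun t =>
    ⟨1, fun s => by by_cases h : s = t <;> simp [h]⟩
  set K : ℝ := lyapunov s₀ + 2 * (16 * n) ^ n with hK
  have hK0 : 0 < K := by have := lyapunov_pos s₀; positivity
  have hsum : ∀ (F : State n → ℝ) (C : ℝ), (∀ s, |F s| ≤ C) →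
      HasSum (fun s => φ (Pi.single s 1) * F s) (φ F) := by
    intro F C hF
    have hC0 : 0 ≤ C := (abs_nonneg _).trans (hF s₀)
    refine Metric.tendsto_atTop.2 fun ε hε => ?_
    -- Outside the finite set where the Lyapunov function is at most c, F is bounded by C/c times
    -- that function, whose means are at most K; this choice gives C K / c < ε.
    set c : ℝ := 2 * (C + 1) * K / ε with hc
    have hc0 : 0 < c := by positivity
    refine ⟨(finite_lyapunov_le n c).toFinset, fun S hS => ?_⟩
    set E : State n → ℝ := F - ∑ s ∈ S, F s • Pi.single s 1 with hE
    have hEs : ∀ s, E s = if s ∈ S then 0 else F s := by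
      intro s
      simp only [hE, Pi.sub_apply, Finset.sum_apply, Pi.smul_apply, Pi.single_apply, smul_eq_mul,
        mul_ite, mul_one, mul_zero, Finset.sum_ite_eq]
      split_ifs <;> simp
    have hEV : ∀ s, |E s| ≤ (C / c) * lyapunov s := by
      intro s
      rw [hEs]
      split_ifs with h
      · have := lyapunov_pos s
        simp only [abs_zero]; positivity
      · have h1 : c < lyapunov s := by
          by_contra h2
          exact h (hS (by simpa using h2))
        refine (hF s).trans ?_
        rw [div_mul_eq_mul_div, le_div_iff₀ hc0]
        exact mul_le_mul_of_nonneg_left h1.le hC0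
    have hceE : ∀ N, |cesaro lam κ s₀ N E| ≤ (C / c) * K := by
      intro N
      have hV : cesaro lam κ s₀ N ((C / c) • lyapunov) ≤ (C / c) * K := by
        rw [map_smul, smul_eq_mul]
        exact mul_le_mul_of_nonneg_left (cesaro_le_of_uniformized_pow_le
          (fun k => uniformized_pow_lyapunov_le hl hl' hκ hn s₀ k) N) (by positivity)
      have h1 := cesaro_mono hl hκ s₀ N
        (show E ≤ (C / c) • lyapunov from fun s => (abs_le.1 (hEV s)).2)
      have h2 := cesaro_mono hl hκ s₀ N
        (show -((C / c) • lyapunov) ≤ E from fun s => (abs_le.1 (hEV s)).1)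
      rw [map_neg] at h2
      exact abs_le.2 ⟨by linarith, by linarith⟩
    have hlimE : Filter.Tendsto (fun N => cesaro lam κ s₀ N E) U
        (nhds (φ F - ∑ s ∈ S, F s * φ (Pi.single s 1))) := by
      simp only [hE, map_sub, map_sum, map_smul, smul_eq_mul]
      exact (hφ F ⟨C, hF⟩).sub (tendsto_finsetSum _ fun s _ => (hφ _ (hind s)).const_mul _)
    have h3 := le_of_tendsto hlimE.abs (Filter.Eventually.of_forall hceE)
    rw [Real.dist_eq, abs_sub_comm]
    simp only [mul_comm (φ _)]
    refine h3.trans_lt ?_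
    rw [hc, div_mul_eq_mul_div, div_lt_iff₀ (by positivity)]
    rw [show ε * (2 * (C + 1) * K / ε) = 2 * (C + 1) * K by field_simp]
    nlinarith
  have hpos : ∀ s, 0 ≤ φ (Pi.single s 1) := by
    intro s
    refine ge_of_tendsto (hφ _ (hind s)) (Filter.Eventually.of_forall fun N => ?_)
    have := cesaro_mono hl hκ s₀ N (show (fun _ => (0 : ℝ)) ≤ Pi.single s 1 from
      fun t => by by_cases h : t = s <;> simp [h])
    rwa [cesaro_const] at this
  have hone : φ (fun _ => 1) = 1 := by
    refine tendsto_nhds_unique (hφ (fun _ => 1) ⟨1, by simp⟩) ?_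
    simp only [cesaro_const]
    exact tendsto_const_nhds
  have h1 : HasSum (fun s => φ (Pi.single s 1)) 1 := by
    simpa [hone] using hsum (fun _ => 1) 1 (by simp)
  have h2 : HasSum (fun s => ENNReal.ofReal (φ (Pi.single s 1))) 1 := by
    have := ENNReal.ofReal_tsum_of_nonneg hpos h1.summable
    rw [h1.tsum_eq, ENNReal.ofReal_one] at this
    rw [this]
    exact ENNReal.summable.hasSum
  refine ⟨⟨fun s => ENNReal.ofReal (φ (Pi.single s 1)), h2⟩, fun f ⟨C, hC⟩ => ?_⟩
  have hgb := abs_generator_le hl hκ hC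
  have h3 : φ (generator lam κ f) = 0 := by
    refine tendsto_nhds_unique (hφ _ ⟨_, hgb⟩) ?_
    refine squeeze_zero_norm (fun N => abs_cesaro_generator_le hl hκ s₀ hC N) ?_
    have : Filter.Tendsto (fun N : ℕ => ((N : ℝ) + 1)⁻¹) U (nhds 0) :=
      (tendsto_inv_atTop_zero.comp (Filter.tendsto_atTop_add_const_right _ 1
        tendsto_natCast_atTop_atTop)).mono_left hUt
    simpa using this.const_mul ((totalRate lam κ n + 1) * (2 * C))
  rw [← h3, ← (hsum _ _ hgb).tsum_eq]
  refine tsum_congr fun s => ?_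
  congr 1
  exact ENNReal.toReal_ofReal (hpos s)

theorem exists_perfectMatching {n : ℕ} (hn : Even n) : Nonempty (PerfectMatching n) := by
  refine ⟨⟨Fin.revPerm, fun v => by simp, fun v h => ?_⟩⟩
  have := congrArg Fin.val h
  simp only [Fin.revPerm_apply, Fin.val_rev] at this
  obtain ⟨k, hk⟩ := hn
  omega

/-! ### Relabelling symmetry and uniqueness of the tails -/

theorem tailDrift_add (lam : ℝ) (F G : ℕ → ℕ → ℝ) (a b : ℕ) :
    tailDrift lam (fun i j => F i j + G i j) a b = tailDrift lam F a b + tailDrift lam G a b := by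
  unfold tailDrift
  split_ifs <;> ring

theorem tailGenerator_add (lam κ : ℝ) {n : ℕ} (D E : (Fin n → ℕ) → PerfectMatching n → ℝ)
    (m : Fin n → ℕ) (M : PerfectMatching n) : tailGenerator lam κ (fun m M => D m M + E m M) m M
      = tailGenerator lam κ D m M + tailGenerator lam κ E m M := by
  simp only [tailGenerator, tailDrift_add, add_sub_add_comm, Finset.sum_add_distrib]
  ring

theorem tailGenerator_mul_right (lam κ : ℝ) {n : ℕ} (D : (Fin n → ℕ) → PerfectMatching n → ℝ)
    (c : ℝ) (m : Fin n → ℕ) (M : PerfectMatching n) :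
    tailGenerator lam κ (fun m M => D m M * c) m M = tailGenerator lam κ D m M * c := by
  simp only [tailGenerator, tailDrift_mul_right, ← sub_mul, ← Finset.sum_mul]
  ring

theorem tailGenerator_sub (lam κ : ℝ) {n : ℕ} (D E : (Fin n → ℕ) → PerfectMatching n → ℝ)
    (m : Fin n → ℕ) (M : PerfectMatching n) : tailGenerator lam κ (fun m M => D m M - E m M) m M
      = tailGenerator lam κ D m M - tailGenerator lam κ E m M := by
  have h := tailGenerator_add lam κ D (fun m M => E m M * (-1)) m M
  rw [tailGenerator_mul_right] at h
  simpa [sub_eq_add_neg] using h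

theorem tailGenerator_sum (lam κ : ℝ) {n : ℕ} {ι : Type*} (S : Finset ι)
    (D : ι → (Fin n → ℕ) → PerfectMatching n → ℝ) (m : Fin n → ℕ) (M : PerfectMatching n) :
    tailGenerator lam κ (fun m M => ∑ x ∈ S, D x m M) m M
      = ∑ x ∈ S, tailGenerator lam κ (D x) m M := by
  classical
  induction S using Finset.induction_on with
  | empty => simp [tailGenerator, tailDrift]
  | insert x S hx ih => simp only [Finset.sum_insert hx, tailGenerator_add, ih]

/-- The matching `M` transported along the relabelling `σ⁻¹` of the vertices. -/
def relabel {n : ℕ} (σ : Equiv.Perm (Fin n)) (M : PerfectMatching n) : PerfectMatching n :=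
  ⟨σ⁻¹ * M.1 * σ, fun v => by simp [M.2.1], fun v h => M.2.2 (σ v) (by
    have h' : σ⁻¹ (M.1 (σ v)) = v := h
    rwa [Equiv.Perm.inv_eq_iff_eq] at h')⟩

theorem relabel_mul {n : ℕ} (σ τ : Equiv.Perm (Fin n)) (M : PerfectMatching n) :
    relabel (σ * τ) M = relabel τ (relabel σ M) := by
  apply Subtype.ext
  simp [relabel, mul_assoc]

theorem relabel_one {n : ℕ} (M : PerfectMatching n) : relabel 1 M = M := by
  apply Subtype.ext
  simp [relabel]

/-- Relabelling as a permutation of the matchings. -/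
def relabelEquiv {n : ℕ} (σ : Equiv.Perm (Fin n)) : PerfectMatching n ≃ PerfectMatching n where
  toFun := relabel σ
  invFun := relabel σ⁻¹
  left_inv M := by rw [← relabel_mul, mul_inv_cancel, relabel_one]
  right_inv M := by rw [← relabel_mul, inv_mul_cancel, relabel_one]

theorem relabel_swapMembership {n : ℕ} (σ : Equiv.Perm (Fin n)) (u v : Fin n)
    (M : PerfectMatching n) :
    relabel σ (swapMembership (σ u) (σ v) M) = swapMembership u v (relabel σ M) := by
  apply Subtype.ext
  simp only [relabel, swapMembership]
  have h := Equiv.mul_swap_eq_swap_mul σ u v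
  have h' : σ⁻¹ * Equiv.swap (σ u) (σ v) = Equiv.swap u v * σ⁻¹ := by
    rw [inv_mul_eq_iff_eq_mul, ← mul_assoc, h, mul_assoc, mul_inv_cancel, mul_one]
  calc σ⁻¹ * (Equiv.swap (σ u) (σ v) * M.1 * Equiv.swap (σ u) (σ v)) * σ
      = (σ⁻¹ * Equiv.swap (σ u) (σ v)) * M.1 * (Equiv.swap (σ u) (σ v) * σ) := by
        simp only [mul_assoc]
    _ = _ := by rw [h', ← h]; simp only [mul_assoc]

theorem setPair_comp {n : ℕ} (m : Fin n → ℕ) (σ : Equiv.Perm (Fin n)) (v w : Fin n) (i j : ℕ) :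
    setPair m (σ v) (σ w) i j ∘ σ = setPair (m ∘ σ) v w i j := by
  ext x
  simp [setPair, Function.update_apply]

theorem tailGenerator_relabel (lam κ : ℝ) {n : ℕ} (D : (Fin n → ℕ) → PerfectMatching n → ℝ)
    (σ : Equiv.Perm (Fin n)) (m : Fin n → ℕ) (M : PerfectMatching n) :
    tailGenerator lam κ (fun m M => D (m ∘ σ) (relabel σ M)) m M
      = tailGenerator lam κ D (m ∘ σ) (relabel σ M) := by
  unfold tailGenerator
  congr 1
  · rw [← Equiv.sum_comp σ]
    refine Finset.sum_congr rfl fun v _ => ?_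
    have h : M.1 (σ v) = σ ((relabel σ M).1 v) := by simp [relabel]
    simp only [h, setPair_comp, Function.comp]
  · congr 2
    rw [← Equiv.sum_comp σ]
    refine Finset.sum_congr rfl fun v _ => ?_
    rw [← Equiv.sum_comp σ]
    simp only [relabel_swapMembership]

theorem sum_comp_perm {n : ℕ} (m : Fin n → ℕ) (σ : Equiv.Perm (Fin n)) :
    ∑ v, (m ∘ σ) v = ∑ v, m v := Equiv.sum_comp σ m

theorem isConj_perfectMatching {n : ℕ} (M M' : PerfectMatching n) : IsConj M.1 M'.1 := by
  rw [Equiv.Perm.isConj_iff_cycleType_eq]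
  have : Fact (Nat.Prime 2) := ⟨Nat.prime_two⟩
  have h : ∀ M : PerfectMatching n, M.1.cycleType = Multiset.replicate (n / 2) 2 := by
    intro M
    have h1 := Equiv.Perm.cycleType_of_pow_prime_eq_one (σ := M.1) (p := 2)
      (Equiv.ext fun v => by simp [pow_two, M.2.1])
    have h2 := M.1.sum_cycleType
    have h3 : M.1.support = Finset.univ :=
      Finset.eq_univ_of_forall fun v => Equiv.Perm.mem_support.2 (M.2.2 v)
    rw [h3, Finset.card_univ, Fintype.card_fin, h1, Multiset.sum_replicate, smul_eq_mul] at h2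
    rw [h1]
    congr 1
    omega
  rw [h, h]

/-- The centralizer of a matching is transitive on vertices: exchange the two pairs as wholes, or
apply M itself when x and i are partners. -/
theorem exists_commuting_perm {n : ℕ} (M : PerfectMatching n) (x i : Fin n) :
    ∃ d : Equiv.Perm (Fin n), d * M.1 = M.1 * d ∧ d x = i := by
  have hne := M.2.2
  have hinv := M.2.1
  by_cases h1 : x = i
  · exact ⟨1, by simp, by simp [h1]⟩
  by_cases h2 : x = M.1 i
  · exact ⟨M.1, rfl, by rw [h2, hinv]⟩
  have h3 : M.1 x ≠ i := fun h => h2 (by rw [← h, hinv])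
  have h4 : M.1 x ≠ M.1 i := fun h => h1 (M.1.injective h)
  refine ⟨Equiv.swap x i * Equiv.swap (M.1 x) (M.1 i), ?_, ?_⟩
  · have hc : Equiv.swap x i * Equiv.swap (M.1 x) (M.1 i)
        = Equiv.swap (M.1 x) (M.1 i) * Equiv.swap x i := by
      refine (Equiv.Perm.disjoint_swap_swap ?_).commute
      simp only [List.nodup_cons, List.mem_cons, List.not_mem_nil, or_false, not_or,
        List.nodup_nil, and_true, not_false_eq_true]
      exact ⟨⟨h1, (hne x).symm, h2⟩, ⟨h3.symm, (hne i).symm⟩, h4⟩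
    have h5 := Equiv.mul_swap_eq_swap_mul M.1 x i
    have h6 := Equiv.mul_swap_eq_swap_mul M.1 (M.1 x) (M.1 i)
    rw [hinv, hinv] at h6
    rw [← mul_assoc, h5, hc, mul_assoc, ← h6, ← mul_assoc]
  · rw [Equiv.Perm.mul_apply, Equiv.swap_apply_of_ne_of_ne (hne x).symm h2, Equiv.swap_apply_left]

/-- Any two matchings are conjugate, and a conjugator can be corrected by an element of the
centralizer of M' so as to fix i. -/
theorem exists_relabel_eq {n : ℕ} (M M' : PerfectMatching n) (i : Fin n) :
    ∃ τ : Equiv.Perm (Fin n), τ i = i ∧ relabel τ M = M' := by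
  obtain ⟨c, hc⟩ := isConj_iff.1 (isConj_perfectMatching M M')
  obtain ⟨d, hd, hdi⟩ := exists_commuting_perm M' (c i) i
  refine ⟨(d * c)⁻¹, ?_, Subtype.ext ?_⟩
  · rw [Equiv.Perm.inv_eq_iff_eq]
    simp [hdi]
  · simp only [relabel, inv_inv]
    calc d * c * M.1 * (d * c)⁻¹ = d * (c * M.1 * c⁻¹) * d⁻¹ := by
          simp only [mul_inv_rev, mul_assoc]
      _ = M'.1 := by rw [hc, hd, mul_assoc, mul_inv_cancel, mul_one]

/-- The joint tails under a stationary distribution, conditioned on the matching. -/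
structure IsTailSolution (lam κ : ℝ) {n : ℕ} (D : (Fin n → ℕ) → PerfectMatching n → ℝ) : Prop where
  bound : ∃ A : ℝ, ∀ m M, |D m M| ≤ A * (1 / 2) ^ (∑ v, m v)
  zero : ∀ M, D 0 M = 1
  generator_eq : ∀ m M, tailGenerator lam κ D m M = 0

theorem IsTailSolution.eq {lam κ : ℝ} (hl : 0 ≤ lam) (hl' : lam ≤ 1 / 100) (hκ : 0 ≤ κ) {n : ℕ}
    {D E : (Fin n → ℕ) → PerfectMatching n → ℝ} (hD : IsTailSolution lam κ D)
    (hE : IsTailSolution lam κ E) (m : Fin n → ℕ) (M : PerfectMatching n) : D m M = E m M := by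
  obtain ⟨A, hA⟩ := hD.bound
  obtain ⟨B, hB⟩ := hE.bound
  have h := tailGenerator_contraction hl hl' hκ (D := fun m M => D m M - E m M) (A := A + B)
    (ε := 0) (fun m M => ?_) (fun M => by rw [hD.zero, hE.zero, sub_self]) le_rfl
    (fun m M => by rw [tailGenerator_sub, hD.generator_eq, hE.generator_eq]; simp) m M
  · simp only [mul_zero, zero_mul, abs_nonpos_iff] at h
    linarith
  · refine (abs_sub _ _).trans ?_
    rw [add_mul]
    exact add_le_add (hA m M) (hB m M)

theorem IsTailSolution.relabel {lam κ : ℝ} {n : ℕ} {D : (Fin n → ℕ) → PerfectMatching n → ℝ}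
    (hD : IsTailSolution lam κ D) (σ : Equiv.Perm (Fin n)) :
    IsTailSolution lam κ fun m M => D (m ∘ σ) (relabel σ M) where
  bound := by
    obtain ⟨A, hA⟩ := hD.bound
    exact ⟨A, fun m M => (hA _ _).trans (by rw [sum_comp_perm])⟩
  zero M := hD.zero _
  generator_eq m M := by rw [tailGenerator_relabel, hD.generator_eq]

theorem sum_jointTail_zero {n : ℕ} (μ : PMF (State n)) : ∑ M, jointTail μ 0 M = 1 := by
  classical
  refine HasSum.unique (hasSum_sum fun M _ => hasSum_jointTail μ 0 M) ?_
  refine (hasSum_toReal μ).congr_fun fun s => ?_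
  rw [← Finset.mul_sum]
  simp [tailInd, geIndProd, geInd]

/-- Averaging over the stabilizer of i makes the matching uniform, because the stabilizer is
transitive on matchings, while the marginal of queue i is unchanged. This is needed for κ = 0, where
the law of the matching is arbitrary. -/
theorem IsStationary.exists_isTailSolution {lam κ : ℝ} (hl : 0 ≤ lam) (hl' : lam ≤ 1 / 4)
    (hκ : 0 ≤ κ) {n : ℕ} (hn : 0 < n) [Nonempty (PerfectMatching n)] {μ : PMF (State n)}
    (hμ : IsStationary lam κ μ) (i : Fin n) :
    ∃ D : (Fin n → ℕ) → PerfectMatching n → ℝ, IsTailSolution lam κ D ∧ ∀ k,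
      ∑ M, jointTail μ (Pi.single i k) M
        = (Fintype.card (PerfectMatching n) : ℝ)⁻¹ * ∑ M, D (Pi.single i k) M := by
  classical
  set G : Finset (Equiv.Perm (Fin n)) := Finset.univ.filter fun σ => σ i = i with hG
  have hG1 : (1 : Equiv.Perm (Fin n)) ∈ G := by simp [hG]
  have hGc : (0 : ℝ) < G.card := by exact_mod_cast Finset.card_pos.2 ⟨1, hG1⟩
  set N : ℝ := ((Fintype.card (PerfectMatching n) : ℕ) : ℝ) with hN
  have hN0 : 0 < N := by rw [hN]; exact_mod_cast Fintype.card_pos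
  set Z : (Fin n → ℕ) → PerfectMatching n → ℝ :=
    fun m M => ∑ σ ∈ G, jointTail μ (m ∘ σ) (Supermarket.relabel σ M) with hZ
  have hinv : ∀ τ ∈ G, ∀ M, Z 0 (Supermarket.relabel τ M) = Z 0 M := by
    intro τ hτ M
    simp only [hG, Finset.mem_filter, Finset.mem_univ, true_and] at hτ
    simp only [hZ, ← relabel_mul]
    refine Finset.sum_equiv (Equiv.mulLeft τ) (fun σ => ?_) fun σ _ => rfl
    simp only [hG, Finset.mem_filter, Finset.mem_univ, true_and, Equiv.coe_mulLeft,
      Equiv.Perm.mul_apply]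
    constructor
    · intro h; rw [h, hτ]
    · intro h; exact τ.injective (by rw [h, hτ])
  have hsum : ∀ k, ∑ M, Z (Pi.single i k) M
      = G.card * ∑ M, jointTail μ (Pi.single i k) M := by
    intro k
    simp only [hZ]
    rw [Finset.sum_comm, ← nsmul_eq_mul, ← Finset.sum_const]
    refine Finset.sum_congr rfl fun σ hσ => ?_
    simp only [hG, Finset.mem_filter, Finset.mem_univ, true_and] at hσ
    have h1 : (Pi.single i k : Fin n → ℕ) ∘ σ = Pi.single i k := by
      ext v
      simp only [Function.comp, Pi.single_apply]
      congr 1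
      rw [eq_iff_iff]
      exact ⟨fun h => σ.injective (by rw [h, hσ]), fun h => by rw [h, hσ]⟩
    rw [h1]
    exact Equiv.sum_comp (relabelEquiv σ) fun M => jointTail μ (Pi.single i k) M
  have hZ0 : ∀ M, Z 0 M = G.card / N := by
    intro M
    have h1 : ∀ M', Z 0 M' = Z 0 M := by
      intro M'
      obtain ⟨τ, hτ, rfl⟩ := exists_relabel_eq M M' i
      exact hinv τ (by simp [hG, hτ]) M
    have h2 := hsum 0
    simp only [Pi.single_zero] at h2
    rw [sum_jointTail_zero, Finset.sum_congr rfl fun M' _ => h1 M', Finset.sum_const,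
      Finset.card_univ, nsmul_eq_mul, mul_one] at h2
    rw [eq_div_iff hN0.ne', mul_comm]
    exact h2
  -- The factor turns averaged joint tails into tails conditional on the matching, whose value at m
  -- = 0 is 1.
  refine ⟨fun m M => Z m M * (N / G.card), ⟨?_, ?_, ?_⟩, ?_⟩
  · refine ⟨(G.card * (2 * (16 * n) ^ n)) * (N / G.card), fun m M => ?_⟩
    rw [abs_mul, abs_of_pos (by positivity : 0 < N / G.card), mul_right_comm]
    refine mul_le_mul_of_nonneg_right ?_ (by positivity)
    refine (Finset.abs_sum_le_sum_abs _ _).trans ?_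
    rw [mul_assoc, ← nsmul_eq_mul]
    refine Finset.sum_le_card_nsmul _ _ _ fun σ _ => ?_
    rw [abs_of_nonneg (jointTail_nonneg _ _ _), ← sum_comp_perm m σ]
    exact hμ.jointTail_le hl hl' hκ hn _ _
  · intro M
    rw [hZ0]
    field_simp
  · intro m M
    rw [tailGenerator_mul_right, hZ, tailGenerator_sum]
    simp only [tailGenerator_relabel, hμ.tailGenerator_jointTail, Finset.sum_const_zero, zero_mul]
  · intro k
    rw [← Finset.sum_mul, hsum]
    field_simp

/-- The probability that a given queue has length at least `k`, for the conditional tails `D`. -/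
noncomputable def queueTail {n : ℕ} (D : (Fin n → ℕ) → PerfectMatching n → ℝ) (i : Fin n) (k : ℕ) :
    ℝ := (Fintype.card (PerfectMatching n) : ℝ)⁻¹ * ∑ M, D (Pi.single i k) M

/-- By uniqueness D is E relabelled by the transposition of i and j, and summing over all matchings
removes the relabelling. -/
theorem IsTailSolution.queueTail_eq {lam κ : ℝ} (hl : 0 ≤ lam) (hl' : lam ≤ 1 / 100) (hκ : 0 ≤ κ)
    {n : ℕ} {D E : (Fin n → ℕ) → PerfectMatching n → ℝ} (hD : IsTailSolution lam κ D)
    (hE : IsTailSolution lam κ E) (i j : Fin n) (k : ℕ) : queueTail D i k = queueTail E j k := by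
  unfold queueTail
  congr 1
  set σ : Equiv.Perm (Fin n) := Equiv.swap i j
  have h : ∀ M, D (Pi.single i k) M = E (Pi.single j k) (Supermarket.relabel σ M) := by
    intro M
    rw [hD.eq hl hl' hκ (hE.relabel σ)]
    congr 1
    ext v
    simp only [Function.comp, Pi.single_apply]
    congr 1
    rw [eq_iff_iff, Equiv.swap_apply_eq_iff, Equiv.swap_apply_left]
  simp only [h]
  exact Equiv.sum_comp (relabelEquiv σ) fun M => E (Pi.single j k) M

theorem sum_jointTail_single {n : ℕ} (μ : PMF (State n)) (i : Fin n) (k : ℕ) :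
    ∑ M, jointTail μ (Pi.single i k) M = ∑' s, (μ s).toReal * geInd k (s.1 i) := by
  classical
  refine ((hasSum_sum fun M _ => hasSum_jointTail μ (Pi.single i k) M).congr_fun
    fun s => ?_).tsum_eq.symm
  rw [← Finset.mul_sum]
  congr 1
  simp only [tailInd, Finset.sum_ite_eq, Finset.mem_univ, if_true, geIndProd]
  rw [Finset.prod_eq_single i]
  · simp
  · intro v _ hv
    rw [Pi.single_eq_of_ne hv]
    simp [geInd]
  · simp

/-! ### The product over matched pairs as an approximate solution -/

/-- The factor of the matched pair of `w`, assigned to the smaller of the two vertices. -/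
noncomputable def pairFactor (y : ℕ → ℕ → ℝ) {n : ℕ} (m : Fin n → ℕ) (M : PerfectMatching n)
    (w : Fin n) : ℝ := if w < M.1 w then y (m w) (m (M.1 w)) else 1

/-- The product of `y` over the matched pairs of vertices. -/
noncomputable def pairProd (y : ℕ → ℕ → ℝ) {n : ℕ} (m : Fin n → ℕ) (M : PerfectMatching n) : ℝ :=
  ∏ w, pairFactor y m M w

/-- The product of `y` over the matched pairs of vertices other than the pair of `v`. -/
noncomputable def pairProdExcept (y : ℕ → ℕ → ℝ) {n : ℕ} (m : Fin n → ℕ) (M : PerfectMatching n)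
    (v : Fin n) : ℝ := ∏ w ∈ (Finset.univ.erase v).erase (M.1 v), pairFactor y m M w

theorem prod_pairFactor {y : ℕ → ℕ → ℝ} (hs : ∀ a b, y a b = y b a) {n : ℕ} (m : Fin n → ℕ)
    (M : PerfectMatching n) {S : Finset (Fin n)} {v w : Fin n} (hw : M.1 v = w) (hv : v ∈ S)
    (hv' : w ∈ S) : ∏ x ∈ S, pairFactor y m M x
      = y (m v) (m w) * ∏ x ∈ (S.erase v).erase w, pairFactor y m M x := by
  subst hw
  have hne := M.2.2 v
  rw [← Finset.mul_prod_erase _ _ hv,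
    ← Finset.mul_prod_erase _ _ (Finset.mem_erase.2 ⟨hne, hv'⟩), ← mul_assoc]
  congr 1
  simp only [pairFactor, M.2.1]
  rcases lt_or_gt_of_ne hne with h | h
  · rw [if_neg (not_lt.2 h.le), if_pos h, one_mul, hs]
  · rw [if_pos h, if_neg (not_lt.2 h.le), mul_one]

theorem pairProd_eq {y : ℕ → ℕ → ℝ} (hs : ∀ a b, y a b = y b a) {n : ℕ} (m : Fin n → ℕ)
    (M : PerfectMatching n) (v : Fin n) :
    pairProd y m M = y (m v) (m (M.1 v)) * pairProdExcept y m M v :=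
  prod_pairFactor hs m M rfl (Finset.mem_univ _) (Finset.mem_univ _)

theorem pairProdExcept_partner (y : ℕ → ℕ → ℝ) {n : ℕ} (m : Fin n → ℕ) (M : PerfectMatching n)
    (v : Fin n) : pairProdExcept y m M (M.1 v) = pairProdExcept y m M v := by
  rw [pairProdExcept, pairProdExcept, M.2.1, Finset.erase_right_comm]

theorem pairProdExcept_setPair (y : ℕ → ℕ → ℝ) {n : ℕ} (m : Fin n → ℕ) (M : PerfectMatching n)
    (v : Fin n) (i j : ℕ) :
    pairProdExcept y (setPair m v (M.1 v) i j) M v = pairProdExcept y m M v := by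
  refine Finset.prod_congr rfl fun w hw => ?_
  simp only [Finset.mem_erase, Finset.mem_univ, and_true] at hw
  have h1 : M.1 w ≠ M.1 v := fun h => hw.2 (M.1.injective h)
  have h2 : M.1 w ≠ v := fun h => hw.1 (by rw [← h, M.2.1])
  simp [pairFactor, setPair, hw.1, hw.2, h1, h2]

theorem pairProd_setPair {y : ℕ → ℕ → ℝ} (hs : ∀ a b, y a b = y b a) {n : ℕ} (m : Fin n → ℕ)
    (M : PerfectMatching n) (v : Fin n) (i j : ℕ) :
    pairProd y (setPair m v (M.1 v) i j) M = y i j * pairProdExcept y m M v := by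
  have hne := M.2.2 v
  rw [pairProd_eq hs _ M v, pairProdExcept_setPair]
  congr 1
  simp [setPair, hne.symm]

theorem pairProd_pow {n : ℕ} (r : ℝ) (m : Fin n → ℕ) (M : PerfectMatching n) :
    pairProd (fun a b => r ^ (a + b)) m M = r ^ (∑ v, m v) := by
  have h1 : ∀ w, pairFactor (fun a b => r ^ (a + b)) m M w
      = (if w < M.1 w then r ^ m w else 1) * (if w < M.1 w then r ^ m (M.1 w) else 1) := by
    intro w
    unfold pairFactor
    split_ifs
    · exact pow_add _ _ _
    · rw [mul_one]
  have h2 : ∏ w, (if w < M.1 w then r ^ m (M.1 w) else 1)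
      = ∏ w, (if M.1 w < w then r ^ m w else 1) := by
    rw [← Equiv.prod_comp M.1 fun w => if M.1 w < w then r ^ m w else 1]
    simp only [M.2.1]
  simp only [pairProd, h1]
  rw [Finset.prod_mul_distrib, h2, ← Finset.prod_mul_distrib, ← Finset.prod_pow_eq_pow_sum]
  refine Finset.prod_congr rfl fun w _ => ?_
  rcases lt_or_gt_of_ne (M.2.2 w) with h | h
  · rw [if_neg (not_lt.2 h.le), if_pos h, one_mul]
  · rw [if_pos h, if_neg (not_lt.2 h.le), mul_one]

theorem abs_prod_pairFactor_le {y g : ℕ → ℕ → ℝ} (h : ∀ a b, |y a b| ≤ g a b) {n : ℕ}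
    (m : Fin n → ℕ) (M : PerfectMatching n) (S : Finset (Fin n)) :
    |∏ x ∈ S, pairFactor y m M x| ≤ ∏ x ∈ S, pairFactor g m M x := by
  rw [Finset.abs_prod]
  refine Finset.prod_le_prod (fun _ _ => abs_nonneg _) fun x _ => ?_
  unfold pairFactor
  split_ifs
  · exact h _ _
  · simp

theorem swapMembership_self {n : ℕ} (v : Fin n) (M : PerfectMatching n) :
    swapMembership v v M = M := by
  apply Subtype.ext
  change Equiv.swap v v * M.1 * Equiv.swap v v = M.1
  rw [Equiv.swap_self]
  rfl

theorem swapMembership_partner {n : ℕ} (v : Fin n) (M : PerfectMatching n) :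
    swapMembership v (M.1 v) M = M := by
  apply Subtype.ext
  have h := Equiv.mul_swap_eq_swap_mul M.1 v (M.1 v)
  rw [M.2.1, Equiv.swap_comm (M.1 v) v] at h
  change Equiv.swap v (M.1 v) * M.1 * Equiv.swap v (M.1 v) = M.1
  rw [mul_assoc, h, ← mul_assoc, Equiv.swap_mul_self, one_mul]

theorem pairProd_swapMembership {y : ℕ → ℕ → ℝ} (hs : ∀ a b, y a b = y b a) {n : ℕ}
    (m : Fin n → ℕ) (M : PerfectMatching n) {u v : Fin n} (h1 : u ≠ v) (h2 : u ≠ M.1 v) :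
    pairProd y m (swapMembership v u M) = y (m v) (m (M.1 u)) * y (m u) (m (M.1 v)) *
      ∏ x ∈ (((Finset.univ.erase v).erase (M.1 v)).erase u).erase (M.1 u), pairFactor y m M x := by
  have hu := M.2.2 u
  have hv := M.2.2 v
  have h3 : M.1 u ≠ M.1 v := fun h => h1 (M.1.injective h)
  have h4 : M.1 u ≠ v := fun h => h2 (by rw [← h, M.2.1])
  have ap : ∀ w, (swapMembership v u M).1 w = Equiv.swap v u (M.1 (Equiv.swap v u w)) := fun _ => rfl
  have e1 : (swapMembership v u M).1 v = M.1 u := by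
    rw [ap, Equiv.swap_apply_left, Equiv.swap_apply_of_ne_of_ne h4 hu]
  have e2 : (swapMembership v u M).1 u = M.1 v := by
    rw [ap, Equiv.swap_apply_right, Equiv.swap_apply_of_ne_of_ne hv h2.symm]
  rw [pairProd, prod_pairFactor hs m _ e1 (Finset.mem_univ _) (Finset.mem_univ _),
    prod_pairFactor hs m _ e2 (by simp [h1, hu.symm]) (by simp [hv, h3.symm]), ← mul_assoc]
  have hset : (((Finset.univ.erase v).erase (M.1 u)).erase u).erase (M.1 v)
      = (((Finset.univ.erase v).erase (M.1 v)).erase u).erase (M.1 u) := by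
    ext x; simp only [Finset.mem_erase]; tauto
  rw [hset]
  congr 1
  refine Finset.prod_congr rfl fun x hx => ?_
  simp only [Finset.mem_erase, Finset.mem_univ, and_true] at hx
  obtain ⟨x1, x2, x3, x4⟩ := hx
  have e3 : (swapMembership v u M).1 x = M.1 x := by
    rw [ap, Equiv.swap_apply_of_ne_of_ne x4 x2, Equiv.swap_apply_of_ne_of_ne]
    · exact fun h => x3 (by rw [← h, M.2.1])
    · exact fun h => x1 (by rw [← h, M.2.1])
  simp only [pairFactor, e3]

/-- The correlation of the tails of the queues of a matched pair. -/
noncomputable def correlation (y : ℕ → ℕ → ℝ) (a b : ℕ) : ℝ := y a b - y a 0 * y b 0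

/-- The indicator that an entry of the multi-index is nonzero. -/
noncomputable def activeInd (a : ℕ) : ℝ := if a = 0 then 0 else 1

theorem activeInd_nonneg (a : ℕ) : 0 ≤ activeInd a := by unfold activeInd; split_ifs <;> simp

theorem sum_activeInd {n : ℕ} (m : Fin n → ℕ) : ∑ v, activeInd (m v) = active m := by
  simp only [activeInd, active, Finset.card_filter, Nat.cast_sum]
  refine Finset.sum_congr rfl fun v _ => ?_
  by_cases h : m v = 0 <;> simp [h]

theorem correlation_comm {y : ℕ → ℕ → ℝ} (hs : ∀ a b, y a b = y b a) (a b : ℕ) :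
    correlation y a b = correlation y b a := by
  rw [correlation, correlation, hs a b, mul_comm]

theorem abs_le_activeInd_mul {y : ℕ → ℕ → ℝ} (hy : y 0 0 = 1) (hs : ∀ a b, y a b = y b a)
    {a b : ℕ} {c x : ℝ} (h : |c * correlation y a b| ≤ x) :
    |c * correlation y a b| ≤ activeInd a * activeInd b * x := by
  unfold activeInd
  by_cases ha : a = 0
  · subst ha; simp [correlation, hy, hs 0 b]
  by_cases hb : b = 0
  · subst hb; simp [correlation, hy]
  simpa [ha, hb] using h

theorem abs_correlation_le_pow {y : ℕ → ℕ → ℝ} (hy : IsSmallTail (1 / 100) y)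
    (hs : ∀ a b, y a b = y b a) (a b : ℕ) : |correlation y a b| ≤ (1 / 4) ^ (a + b) := by
  have hp : (0 : ℝ) < (1 / 4) ^ (a + b) := by positivity
  by_cases ha : a = 0
  · subst ha; simp [correlation, hy.1, hs 0 b]
  by_cases hb : b = 0
  · subst hb; simp [correlation, hy.1]
  refine (abs_sub _ _).trans ?_
  have h1 := hy.2 a b (Or.inl ha)
  have h2 := mul_le_mul (hy.2 a 0 (Or.inl ha)) (hy.2 b 0 (Or.inl hb)) (abs_nonneg _)
    (by positivity)
  have e : (1 / 100 * (1 / 4 : ℝ) ^ (a + 0)) * (1 / 100 * (1 / 4) ^ (b + 0))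
      = 1 / 10000 * (1 / 4) ^ (a + b) := by rw [pow_add _ a b]; simp only [add_zero]; ring
  rw [abs_mul]
  rw [e] at h2
  linarith

/-- The added terms are the mean effect of refreshing both pairs by independent partners. The
remaining error needs nonzero entries at two of the sites involved, so its sum over u and v is
quadratic in `active m` instead of growing with n. -/
theorem abs_swap_error_le {κ : ℝ} {y : ℕ → ℕ → ℝ} (hy : IsSmallTail (1 / 100) y)
    (hs : ∀ a b, y a b = y b a)
    (hz : ∀ a b, |κ * correlation y a b| ≤ 1 / 100 * (1 / 4) ^ (a + b)) {n : ℕ}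
    (m : Fin n → ℕ) (M : PerfectMatching n) (u v : Fin n) :
    |κ * (pairProd y m (swapMembership v u M) - pairProd y m M
        + (correlation y (m v) (m (M.1 v)) * pairProdExcept y m M v
          + correlation y (m u) (m (M.1 u)) * pairProdExcept y m M u))|
      ≤ 1 / 100 * (1 / 4) ^ (∑ v, m v) * (2 * (activeInd (m v) * activeInd (m (M.1 u)))
        + activeInd (m (M.1 v)) * activeInd (m u) + activeInd (m v) * activeInd (m u)) := by
  set g : ℕ → ℕ → ℝ := fun a b => (1 / 4) ^ (a + b) with hg
  have hgs : ∀ a b, g a b = g b a := fun a b => by simp only [hg, add_comm]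
  have hyg : ∀ a b, |y a b| ≤ g a b := fun a b =>
    (hy.abs_le_pow (by norm_num) a b).trans (le_of_eq (one_mul _))
  have hzi := fun a b => abs_le_activeInd_mul hy.1 hs (hz a b)
  have hzi' : ∀ a b, |correlation y a b| ≤ activeInd a * activeInd b * g a b := fun a b => by
    have := abs_le_activeInd_mul hy.1 hs (c := 1) (x := g a b) (a := a) (b := b)
      (by rw [one_mul]; exact abs_correlation_le_pow hy hs a b)
    rwa [one_mul] at this
  -- When the swap does nothing, both compensating terms survive and coincide; they vanish unless
  -- both entries of the pair are nonzero.
  by_cases h : u = v ∨ u = M.1 v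
  · have e1 : swapMembership v u M = M := by
      rcases h with rfl | rfl
      · exact swapMembership_self _ _
      · exact swapMembership_partner _ _
    have e2 : correlation y (m u) (m (M.1 u)) * pairProdExcept y m M u
        = correlation y (m v) (m (M.1 v)) * pairProdExcept y m M v := by
      rcases h with rfl | rfl
      · rfl
      · rw [M.2.1, pairProdExcept_partner, correlation_comm hs]
    have e3 : 2 * (activeInd (m v) * activeInd (m (M.1 v)))
        ≤ 2 * (activeInd (m v) * activeInd (m (M.1 u)))
        + activeInd (m (M.1 v)) * activeInd (m u) + activeInd (m v) * activeInd (m u) := by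
      have h1 := activeInd_nonneg (m v)
      have h2 := activeInd_nonneg (m (M.1 v))
      rcases h with rfl | rfl
      · nlinarith [mul_nonneg h1 h2]
      · rw [M.2.1]
        have : activeInd (m v) * activeInd (m (M.1 v)) ≤ activeInd (m v) * activeInd (m v) := by
          unfold activeInd; split_ifs <;> norm_num
        nlinarith [mul_nonneg h2 h2, mul_nonneg h1 h2]
    rw [e1, e2, sub_self, zero_add]
    have e4 : (1 / 4 : ℝ) ^ (∑ v, m v) = g (m v) (m (M.1 v)) * pairProdExcept g m M v := by
      rw [← pairProd_pow _ m M, ← pairProd_eq hgs]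
    have e5 : |pairProdExcept y m M v| ≤ pairProdExcept g m M v := abs_prod_pairFactor_le hyg _ _ _
    have e6 := hzi (m v) (m (M.1 v))
    calc _ = 2 * (|κ * correlation y (m v) (m (M.1 v))| * |pairProdExcept y m M v|) := by
          rw [← abs_mul, ← two_mul, ← abs_two (α := ℝ), ← abs_mul, abs_two]
          congr 1; ring
      _ ≤ 2 * ((activeInd (m v) * activeInd (m (M.1 v)) * (1 / 100 * g (m v) (m (M.1 v))))
            * pairProdExcept g m M v) := by
          refine mul_le_mul_of_nonneg_left ?_ (by norm_num)
          exact mul_le_mul e6 e5 (abs_nonneg _) ((abs_nonneg _).trans e6)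
      _ = 1 / 100 * (1 / 4) ^ (∑ v, m v) * (2 * (activeInd (m v) * activeInd (m (M.1 v)))) := by
          rw [e4]; ring
      _ ≤ _ := mul_le_mul_of_nonneg_left e3 (by positivity)
  · push Not at h
    obtain ⟨h1, h2⟩ := h
    have hu := M.2.2 u
    have hv := M.2.2 v
    have h3 : M.1 u ≠ M.1 v := fun h => h1 (M.1.injective h)
    have h4 : M.1 u ≠ v := fun h => h2 (by rw [← h, M.2.1])
    set R : (ℕ → ℕ → ℝ) → ℝ := fun f => ∏ x ∈ (((Finset.univ.erase v).erase (M.1 v)).erase u).erase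
      (M.1 u), pairFactor f m M x with hR
    have ev : ∀ f : ℕ → ℕ → ℝ, (∀ a b, f a b = f b a) →
        pairProdExcept f m M v = f (m u) (m (M.1 u)) * R f := fun f hf =>
      prod_pairFactor hf m M rfl (by simp [h1, h2]) (by simp [h3, h4])
    have eu : pairProdExcept y m M u = y (m v) (m (M.1 v)) * R y := by
      rw [pairProdExcept, prod_pairFactor hs m M (v := v) rfl (by simp [h1.symm, h4.symm])
        (by simp [h2.symm, h3.symm])]
      have hset : (((Finset.univ.erase u).erase (M.1 u)).erase v).erase (M.1 v)
          = (((Finset.univ.erase v).erase (M.1 v)).erase u).erase (M.1 u) := by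
        ext x; simp only [Finset.mem_erase]; tauto
      rw [hset]
    have hRg : |R y| ≤ R g := abs_prod_pairFactor_le hyg _ _ _
    have hRg0 : 0 ≤ R g := (abs_nonneg _).trans hRg
    have hW : (1 / 4 : ℝ) ^ (∑ v, m v)
        = g (m v) (m (M.1 v)) * (g (m u) (m (M.1 u)) * R g) := by
      rw [← pairProd_pow _ m M, ← ev g hgs, ← pairProd_eq hgs]
    rw [pairProd_swapMembership hs m M h1 h2, pairProd_eq hs m M v, ev y hs, eu, hW]
    change |κ * (_ * _ * R y - _ + _)| ≤ _
    generalize m v = a at *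
    generalize m (M.1 v) = b at *
    generalize m u = c at *
    generalize m (M.1 u) = d at *
    -- Substituting y = correlation + product of marginals, the pure product of four marginals
    -- cancels. Every remaining κ multiplies a correlation, which makes the bound uniform in κ.
    have key : κ * (y a d * y c b * R y - y a b * (y c d * R y)
        + (correlation y a b * (y c d * R y) + correlation y c d * (y a b * R y)))
        = (κ * correlation y a d * (y c 0 * y b 0) + κ * correlation y b c * (y a 0 * y d 0)
          + κ * correlation y a d * correlation y b c
          + κ * correlation y a b * correlation y c d) * R y := by
      simp only [correlation, hs b c]; ring
    rw [key, abs_mul]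
    have hp : ∀ p q : ℕ, |y p 0 * y q 0| ≤ g p q := by
      intro p q
      have := mul_le_mul (hyg p 0) (hyg q 0) (abs_nonneg _) (by positivity)
      rw [abs_mul]
      refine this.trans (le_of_eq ?_)
      simp only [hg, add_zero, ← pow_add]
    have hi := activeInd_nonneg
    have hg0 : ∀ p q, 0 ≤ g p q := fun p q => by positivity
    have hi1 : ∀ p, activeInd p ≤ 1 := fun p => by unfold activeInd; split_ifs <;> norm_num
    have hz' : ∀ p q, |correlation y p q| ≤ g p q := abs_correlation_le_pow hy hs
    have prod_le : ∀ p q p' q' (t : ℝ), |t| ≤ g p' q' →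
        |κ * correlation y p q * t| ≤ 1 / 100 * (g p q * g p' q') * (activeInd p * activeInd q) := by
      intro p q p' q' t ht
      rw [abs_mul]
      refine (mul_le_mul (hzi p q) ht (abs_nonneg _) ((abs_nonneg _).trans (hzi p q))).trans ?_
      exact le_of_eq (by ring)
    have t1 := prod_le a d c b _ (hp c b)
    have t2 := prod_le b c a d _ (hp a d)
    have t3 := prod_le a d b c _ (hz' b c)
    have t4 : |κ * correlation y a b * correlation y c d|
        ≤ 1 / 100 * (g a b * g c d) * (activeInd a * activeInd c) := by
      rw [abs_mul]
      refine (mul_le_mul (hzi a b) (hzi' c d) (abs_nonneg _)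
        ((abs_nonneg _).trans (hzi a b))).trans ?_
      have e : activeInd a * activeInd b * (activeInd c * activeInd d)
          ≤ activeInd a * activeInd c := by
        have := mul_le_one₀ (hi1 b) (hi d) (hi1 d)
        nlinarith [mul_nonneg (hi a) (hi c)]
      have := mul_le_mul_of_nonneg_left e
        (mul_nonneg (by norm_num : (0 : ℝ) ≤ 1 / 100) (mul_nonneg (hg0 a b) (hg0 c d)))
      refine le_trans (le_of_eq ?_) this
      simp only [hg]; ring
    have g1 : g a d * g c b = g a b * g c d := by simp only [hg, ← pow_add]; congr 1; ring
    have g2 : g b c * g a d = g a b * g c d := by simp only [hg, ← pow_add]; congr 1; ring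
    have g3 : g a d * g b c = g a b * g c d := by simp only [hg, ← pow_add]; congr 1; ring
    rw [g1] at t1
    rw [g2] at t2
    rw [g3] at t3
    calc _ ≤ (1 / 100 * (g a b * g c d) * (2 * (activeInd a * activeInd d)
          + activeInd b * activeInd c + activeInd a * activeInd c)) * R g := by
          refine mul_le_mul ?_ hRg (abs_nonneg _) ?_
          · refine (abs_add_le _ _).trans ?_
            refine (add_le_add_left (abs_add_three _ _ _) _).trans ?_
            linarith
          · have := hi a; have := hi b; have := hi c; have := hi d
            have := hg0 a b; have := hg0 c d
            positivity
      _ = _ := by ring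

/-- The pair equation makes the drifts sum to 2κ times the sum of the correlation terms, which is
exactly the mean-field part of the swaps. What is left is the swap error, of order `active m`
squared over n. -/
theorem abs_tailGenerator_pairProd_le {lam κ : ℝ} {y : ℕ → ℕ → ℝ}
    (hy : IsSmallTail (1 / 100) y) (hs : ∀ a b, y a b = y b a)
    (heq : ∀ a b, tailDrift lam y a b + tailDrift lam y b a + 4 * κ * (y a 0 * y b 0 - y a b) = 0)
    (hz : ∀ a b, |κ * correlation y a b| ≤ 1 / 100 * (1 / 4) ^ (a + b)) {n : ℕ} (hn : 0 < n)
    (m : Fin n → ℕ) (M : PerfectMatching n) :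
    |tailGenerator lam κ (pairProd y) m M|
      ≤ active m * (1 / (25 * n) * (1 / 2) ^ (∑ v, m v)) := by
  have hn' : (0 : ℝ) < n := by exact_mod_cast hn
  set c : Fin n → ℝ := fun v => correlation y (m v) (m (M.1 v)) * pairProdExcept y m M v with hc
  have h1 : ∑ v, tailDrift lam (fun i j => pairProd y (setPair m v (M.1 v) i j) M) (m v) (m (M.1 v))
      = 2 * κ * ∑ v, c v := by
    set t : Fin n → ℝ := fun v => tailDrift lam y (m v) (m (M.1 v)) * pairProdExcept y m M v with ht
    have e1 : ∑ v, t (M.1 v) = ∑ v, t v := Equiv.sum_comp M.1 t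
    have e2 : ∑ v, (t v + t (M.1 v)) = ∑ v, 4 * κ * c v := by
      refine Finset.sum_congr rfl fun v _ => ?_
      simp only [ht, hc, M.2.1, pairProdExcept_partner, correlation]
      linear_combination pairProdExcept y m M v * heq (m v) (m (M.1 v))
    rw [Finset.sum_add_distrib, e1, ← Finset.mul_sum] at e2
    simp only [pairProd_setPair hs, tailDrift_mul_right]
    change ∑ v, t v = _
    linarith
  -- The drift total is spread evenly over all ordered pairs (v, u), so that it compensates each
  -- swap separately.
  have h2 : tailGenerator lam κ (pairProd y) m M = (n : ℝ)⁻¹ * ∑ v : Fin n, ∑ u : Fin n,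
      κ * (pairProd y m (swapMembership v u M) - pairProd y m M + (c v + c u)) := by
    have e : ∑ v : Fin n, ∑ u : Fin n, (c v + c u) = 2 * n * ∑ v, c v := by
      simp only [Finset.sum_add_distrib, Finset.sum_const, Finset.card_univ, Fintype.card_fin,
        nsmul_eq_mul, ← Finset.mul_sum]
      ring
    simp only [← Finset.mul_sum]
    simp only [Finset.sum_add_distrib (f := fun u => pairProd y m (swapMembership _ u M) - _)]
    rw [Finset.sum_add_distrib, e, tailGenerator, h1]
    field_simp
    ring
  have h3 : |∑ v : Fin n, ∑ u : Fin n,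
      κ * (pairProd y m (swapMembership v u M) - pairProd y m M + (c v + c u))|
      ≤ 1 / 100 * (1 / 4) ^ (∑ v, m v) * (4 * ((active m : ℝ) * active m)) := by
    calc _ ≤ ∑ v : Fin n, ∑ u : Fin n, 1 / 100 * (1 / 4) ^ (∑ v, m v) *
          (2 * (activeInd (m v) * activeInd (m (M.1 u)))
          + activeInd (m (M.1 v)) * activeInd (m u) + activeInd (m v) * activeInd (m u)) := by
          refine (Finset.abs_sum_le_sum_abs _ _).trans (Finset.sum_le_sum fun v _ => ?_)
          refine (Finset.abs_sum_le_sum_abs _ _).trans (Finset.sum_le_sum fun u _ => ?_)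
          exact abs_swap_error_le hy hs hz m M u v
      _ = _ := by
          have e : ∑ v, activeInd (m (M.1 v)) = active m := by
            rw [← sum_activeInd]; exact Equiv.sum_comp M.1 fun v => activeInd (m v)
          simp only [← Finset.mul_sum, Finset.sum_add_distrib, ← Finset.sum_mul, sum_activeInd, e]
          ring
  -- One factor `active m` is absorbed by passing from weight 1/4 to 1/2; this is why y is built
  -- with the faster decay.
  have h4 : (active m : ℝ) * (1 / 4) ^ (∑ v, m v) ≤ (1 / 2) ^ (∑ v, m v) := by
    have e1 : active m ≤ ∑ v, m v := by
      rw [active, Finset.card_filter]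
      refine Finset.sum_le_sum fun v _ => ?_
      split_ifs with h
      · exact Nat.one_le_iff_ne_zero.2 h
      · exact Nat.zero_le _
    have e2 : (active m : ℝ) ≤ 2 ^ (∑ v, m v) := by
      exact_mod_cast e1.trans Nat.lt_two_pow_self.le
    calc (active m : ℝ) * (1 / 4) ^ (∑ v, m v) ≤ 2 ^ (∑ v, m v) * (1 / 4) ^ (∑ v, m v) := by gcongr
      _ = _ := by rw [← mul_pow]; norm_num
  rw [h2, abs_mul, abs_of_pos (inv_pos.2 hn')]
  have h5 := mul_le_mul_of_nonneg_left h4 (Nat.cast_nonneg (active m) : (0 : ℝ) ≤ active m)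
  calc _ ≤ (n : ℝ)⁻¹ * (1 / 100 * (1 / 4) ^ (∑ v, m v) * (4 * ((active m : ℝ) * active m))) :=
        mul_le_mul_of_nonneg_left h3 (inv_pos.2 hn').le
    _ = (n : ℝ)⁻¹ * (1 / 25) * (active m * (active m * (1 / 4) ^ (∑ v, m v))) := by ring
    _ ≤ (n : ℝ)⁻¹ * (1 / 25) * (active m * (1 / 2) ^ (∑ v, m v)) :=
        mul_le_mul_of_nonneg_left h5 (by positivity)
    _ = _ := by field_simp

theorem pairProd_single {y : ℕ → ℕ → ℝ} (hy : y 0 0 = 1) (hs : ∀ a b, y a b = y b a) {n : ℕ}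
    (M : PerfectMatching n) (i : Fin n) (k : ℕ) : pairProd y (Pi.single i k) M = y k 0 := by
  have hne := M.2.2 i
  rw [pairProd_eq hs _ M i, Pi.single_eq_same, Pi.single_eq_of_ne hne, pairProdExcept,
    Finset.prod_eq_one, mul_one]
  intro w hw
  simp only [Finset.mem_erase, Finset.mem_univ, and_true] at hw
  have h2 : M.1 w ≠ i := fun h => hw.1 (by rw [← h, M.2.1])
  simp [pairFactor, hw.2, h2, hy]

/-- Stability is applied to D minus the product, which vanishes at m = 0, with ε = 1/(25n). At a
single-site index the product reduces to the marginal of y for every matching. -/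
theorem IsTailSolution.abs_queueTail_sub_le {lam κ : ℝ} (hl : 0 ≤ lam) (hl' : lam ≤ 1 / 2000)
    (hκ : 0 ≤ κ) {y : ℕ → ℕ → ℝ} (hy : IsSmallTail (1 / 100) y) (hs : ∀ a b, y a b = y b a)
    (heq : ∀ a b, tailDrift lam y a b + tailDrift lam y b a + 4 * κ * (y a 0 * y b 0 - y a b) = 0)
    {n : ℕ} (hn : 0 < n) [Nonempty (PerfectMatching n)]
    {D : (Fin n → ℕ) → PerfectMatching n → ℝ} (hD : IsTailSolution lam κ D) (i : Fin n) (k : ℕ) :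
    |queueTail D i k - y k 0| ≤ 4 / (25 * n) * (1 / 2) ^ k := by
  have hn' : (0 : ℝ) < n := by exact_mod_cast hn
  obtain ⟨A, hA⟩ := hD.bound
  have h1 : ∀ M, |D (Pi.single i k) M - y k 0| ≤ 4 / (25 * n) * (1 / 2) ^ k := by
    intro M
    have h := tailGenerator_contraction hl (by linarith) hκ
      (D := fun m M => D m M - pairProd y m M) (A := A + 1) (ε := 1 / (25 * n))
      (fun m M => ?_) (fun M => ?_) (by positivity) (fun m M => ?_) (Pi.single i k) M
    · simp only [pairProd_single hy.1 hs] at h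
      refine h.trans (le_of_eq ?_)
      rw [Finset.sum_pi_single']
      simp only [Finset.mem_univ, if_true]
      ring
    · refine (abs_sub _ _).trans ?_
      rw [add_mul]
      refine add_le_add (hA m M) ?_
      have h2 := abs_prod_pairFactor_le (g := fun a b => (1 / 4) ^ (a + b))
        (fun a b => (hy.abs_le_pow (by norm_num) a b).trans (le_of_eq (one_mul _))) m M Finset.univ
      refine h2.trans ((le_of_eq (pairProd_pow _ m M)).trans ?_)
      rw [one_mul]
      gcongr
      norm_num
    · have h2 := pairProd_single hy.1 hs M i 0
      rw [Pi.single_zero] at h2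
      rw [hD.zero, h2, hy.1, sub_self]
    · rw [tailGenerator_sub, hD.generator_eq, zero_sub, abs_neg]
      exact abs_tailGenerator_pairProd_le hy hs heq
        (fun a b => abs_correlation_le hl hl' hy hs heq a b) hn m M
  have hN : (0 : ℝ) < Fintype.card (PerfectMatching n) := by exact_mod_cast Fintype.card_pos
  have h2 : queueTail D i k - y k 0 = (Fintype.card (PerfectMatching n) : ℝ)⁻¹ *
      ∑ M, (D (Pi.single i k) M - y k 0) := by
    rw [Finset.sum_sub_distrib, Finset.sum_const, Finset.card_univ, nsmul_eq_mul, mul_sub,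
      queueTail]
    field_simp
  rw [h2, abs_mul, abs_of_pos (inv_pos.2 hN), inv_mul_le_iff₀ hN]
  refine (Finset.abs_sum_le_sum_abs _ _).trans ?_
  rw [← nsmul_eq_mul]
  exact Finset.sum_le_card_nsmul _ _ _ fun M _ => h1 M

/-! ### From tails to laws and total variation -/

theorem toReal_map_apply {α : Type*} (μ : PMF α) (f : α → ℕ) (x : ℕ) :
    ((μ.map f) x).toReal = (∑' s, (μ s).toReal * geInd x (f s))
      - ∑' s, (μ s).toReal * geInd (x + 1) (f s) := by
  have hb : ∀ k s, |geInd k (f s)| ≤ 1 := fun k s =>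
    abs_le.2 ⟨by linarith [geInd_nonneg k (f s)], geInd_le_one _ _⟩
  rw [← (summable_toReal_mul μ (hb x)).tsum_sub (summable_toReal_mul μ (hb (x + 1))),
    PMF.map_apply, ENNReal.tsum_toReal_eq]
  · refine tsum_congr fun s => ?_
    rw [← mul_sub]
    rcases lt_trichotomy x (f s) with h | h | h
    · rw [if_neg h.ne, geInd_of_le h.le, geInd_of_le h]; simp
    · rw [if_pos h, geInd_of_le h.le, geInd_of_lt (by omega)]; simp
    · rw [if_neg h.ne', geInd_of_lt h, geInd_of_lt (by omega)]; simp
  · intro s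
    split_ifs
    · exact μ.apply_ne_top s
    · simp

theorem exists_isQueueLaw {lam κ : ℝ} (hl : 0 ≤ lam) (hl' : lam ≤ 1 / 2000)
    (hκ : 0 ≤ κ) {y : ℕ → ℕ → ℝ} (hy : IsSmallTail (1 / 100) y) (hs : ∀ a b, y a b = y b a)
    (heq : ∀ a b, tailDrift lam y a b + tailDrift lam y b a + 4 * κ * (y a 0 * y b 0 - y a b) = 0)
    {n : ℕ} (hn : 0 < n) (he : Even n) : ∃ p : PMF ℕ, IsQueueLaw lam κ n p ∧
      ∀ x, |(p x).toReal - (y x 0 - y (x + 1) 0)| ≤ 6 / (25 * n) * (1 / 2) ^ x := by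
  have hne := exists_perfectMatching he
  have hn' : (0 : ℝ) < n := by exact_mod_cast hn
  obtain ⟨M₀⟩ := id hne
  obtain ⟨μ₀, hμ₀⟩ := exists_isStationary hl (by linarith) hκ hn ((0, M₀) : State n)
  set i₀ : Fin n := ⟨0, hn⟩
  obtain ⟨D₀, hD₀, -⟩ := hμ₀.exists_isTailSolution hl (by linarith) hκ hn i₀
  have key : ∀ μ : PMF (State n), IsStationary lam κ μ → ∀ (i : Fin n) (x : ℕ),
      ((μ.map fun s => s.1 i) x).toReal = queueTail D₀ i₀ x - queueTail D₀ i₀ (x + 1) := by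
    intro μ hμ i x
    obtain ⟨D, hD, hDk⟩ := hμ.exists_isTailSolution hl (by linarith) hκ hn i
    rw [toReal_map_apply, ← sum_jointTail_single, ← sum_jointTail_single, hDk, hDk]
    change queueTail D i x - queueTail D i (x + 1) = _
    rw [hD.queueTail_eq hl (by linarith) hκ hD₀ i i₀ x,
      hD.queueTail_eq hl (by linarith) hκ hD₀ i i₀ (x + 1)]
  refine ⟨μ₀.map fun s => s.1 i₀, ⟨⟨μ₀, hμ₀⟩, fun μ hμ i => ?_⟩, fun x => ?_⟩
  · refine PMF.ext fun x => ?_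
    rw [← ENNReal.toReal_eq_toReal_iff' (PMF.apply_ne_top _ _) (PMF.apply_ne_top _ _),
      key μ hμ, key μ₀ hμ₀]
  · rw [key μ₀ hμ₀]
    have h1 := hD₀.abs_queueTail_sub_le hl hl' hκ hy hs heq hn i₀ x
    have h2 := hD₀.abs_queueTail_sub_le hl hl' hκ hy hs heq hn i₀ (x + 1)
    rw [show queueTail D₀ i₀ x - queueTail D₀ i₀ (x + 1) - (y x 0 - y (x + 1) 0)
      = (queueTail D₀ i₀ x - y x 0) - (queueTail D₀ i₀ (x + 1) - y (x + 1) 0) by ring]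
    refine (abs_sub _ _).trans ((add_le_add h1 h2).trans (le_of_eq ?_))
    rw [pow_succ]; field_simp; ring

theorem tvDist_le {p q : PMF ℕ} {c : ℝ}
    (h : ∀ x, |(p x).toReal - (q x).toReal| ≤ c * (1 / 2) ^ x) : tvDist p q ≤ 2 * c := by
  refine ciSup_le fun A => ?_
  have hm : ∀ r : PMF ℕ, HasSum (fun x => A.indicator (fun x => (r x).toReal) x)
      (r.toMeasure A).toReal := by
    intro r
    have h1 : Summable fun x => A.indicator (fun x => (r x).toReal) x :=
      (hasSum_toReal r).summable.indicator A
    have h2 : (r.toMeasure A).toReal = ∑' x, A.indicator (fun x => (r x).toReal) x := by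
      rw [PMF.toMeasure_apply _ (DiscreteMeasurableSpace.forall_measurableSet A),
        ENNReal.tsum_toReal_eq]
      · refine tsum_congr fun x => ?_
        by_cases hx : x ∈ A <;> simp [hx]
      · intro x
        by_cases hx : x ∈ A <;> simp [hx, PMF.apply_ne_top]
    rw [h2]
    exact h1.hasSum
  have hg : HasSum (fun x : ℕ => c * (1 / 2 : ℝ) ^ x) (c * 2) := hasSum_geometric_two.mul_left c
  have hd := (hm p).sub (hm q)
  have hb : ∀ x, ‖A.indicator (fun x => (p x).toReal) x - A.indicator (fun x => (q x).toReal) x‖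
      ≤ c * (1 / 2) ^ x := by
    intro x
    rw [Real.norm_eq_abs]
    by_cases hx : x ∈ A
    · simpa [hx] using h x
    · simpa [hx] using (abs_nonneg _).trans (h x)
  have := tsum_of_norm_bounded hg hb
  rw [hd.tsum_eq, Real.norm_eq_abs] at this
  linarith

theorem exists_limitLaw {y : ℕ → ℕ → ℝ} (hy : IsSmallTail (1 / 100) y)
    (h : ∀ x, 0 ≤ y x 0 - y (x + 1) 0) :
    ∃ η : PMF ℕ, ∀ x, (η x).toReal = y x 0 - y (x + 1) 0 := by
  have h1 : HasSum (fun x => y x 0 - y (x + 1) 0) 1 := by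
    rw [hasSum_iff_tendsto_nat_of_nonneg h]
    simp only [Finset.sum_range_sub', hy.1]
    have : Filter.Tendsto (fun x => y x 0) Filter.atTop (nhds 0) := by
      refine squeeze_zero_norm (fun x => hy.abs_le_pow (by norm_num) x 0) ?_
      simpa using (tendsto_pow_atTop_nhds_zero_of_lt_one (r := (1 / 4 : ℝ)) (by norm_num)
        (by norm_num))
    simpa using this.const_sub 1
  have h2 : HasSum (fun x => ENNReal.ofReal (y x 0 - y (x + 1) 0)) 1 := by
    have := ENNReal.ofReal_tsum_of_nonneg h h1.summable
    rw [h1.tsum_eq, ENNReal.ofReal_one] at this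
    rw [this]
    exact ENNReal.summable.hasSum
  exact ⟨⟨_, h2⟩, fun x => ENNReal.toReal_ofReal (h x)⟩

end Supermarket

theorem mainTheorem10 :
    ∃ lam₀ : ℝ, 0 < lam₀ ∧ ∀ lam : ℝ, 0 < lam → lam < lam₀ → ∀ κ : ℝ, 0 ≤ κ →
      ∃ (π : ℕ → PMF ℕ) (η : PMF ℕ),
        (∀ n : ℕ, 0 < n → Even n → Supermarket.IsQueueLaw lam κ n (π n)) ∧
        (∀ x : ℕ, Filter.Tendsto (fun n => π n x)
          (Filter.atTop ⊓ Filter.principal {n : ℕ | Even n}) (nhds (η x))) ∧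
        ∀ n : ℕ, 0 < n → Even n → Supermarket.tvDist (π n) η ≤ 1 / (n : ℝ) := by
  refine ⟨1 / 2000, by norm_num, fun lam hl0 hl1 κ hκ => ?_⟩
  obtain ⟨y, hy, hs, heq⟩ := Supermarket.exists_pairTail hl0.le hl1.le hκ
  have hlaw : ∀ n : ℕ, ∃ p : PMF ℕ, 0 < n → Even n → Supermarket.IsQueueLaw lam κ n p ∧
      ∀ x, |(p x).toReal - (y x 0 - y (x + 1) 0)| ≤ 6 / (25 * n) * (1 / 2) ^ x := by
    intro n
    by_cases h : 0 < n ∧ Even n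
    · obtain ⟨p, hp⟩ := Supermarket.exists_isQueueLaw hl0.le hl1.le hκ hy hs heq h.1 h.2
      exact ⟨p, fun _ _ => hp⟩
    -- For n odd or zero the law is an arbitrary default.
    · exact ⟨PMF.pure 0, fun h1 h2 => absurd ⟨h1, h2⟩ h⟩
  choose π hπ using hlaw
  have hle : ∀ n : ℕ, 0 < n → Even n → ∀ x,
      |(π n x).toReal - (y x 0 - y (x + 1) 0)| ≤ 1 / (n : ℝ) := by
    intro n hn he x
    have hn' : (0 : ℝ) < n := by exact_mod_cast hn
    refine ((hπ n hn he).2 x).trans ((mul_le_of_le_one_right (by positivity)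
      (pow_le_one₀ (by norm_num) (by norm_num))).trans ?_)
    rw [div_le_div_iff₀ (by positivity) hn']
    linarith
  -- The fixed point construction does not give monotonicity of the marginal tail; it is inherited
  -- from the queue laws, whose point masses converge to these differences.
  have hnonneg : ∀ x, 0 ≤ y x 0 - y (x + 1) 0 := by
    intro x
    by_contra! h
    obtain ⟨j, hj⟩ := exists_nat_one_div_lt (neg_pos.2 h)
    have h1 := (abs_le.1 (hle (2 * (j + 1)) (by omega) (even_two_mul _) x)).2
    have h2 : (0 : ℝ) ≤ (π (2 * (j + 1)) x).toReal := ENNReal.toReal_nonneg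
    have h3 : 1 / ((2 * (j + 1) : ℕ) : ℝ) ≤ 1 / ((j : ℝ) + 1) := by
      refine one_div_le_one_div_of_le (by positivity) ?_
      push_cast
      linarith [(Nat.cast_nonneg j : (0 : ℝ) ≤ j)]
    linarith
  obtain ⟨η, hη⟩ := Supermarket.exists_limitLaw hy hnonneg
  refine ⟨π, η, fun n hn he => (hπ n hn he).1, fun x => ?_, fun n hn he => ?_⟩
  · rw [← ENNReal.tendsto_toReal_iff (fun n => PMF.apply_ne_top _ _) (PMF.apply_ne_top _ _), hη,
      tendsto_iff_norm_sub_tendsto_zero]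
    have hlim : Filter.Tendsto (fun n : ℕ => 1 / (n : ℝ))
        (Filter.atTop ⊓ Filter.principal {n : ℕ | Even n}) (nhds 0) :=
      tendsto_one_div_atTop_nhds_zero_nat.mono_left inf_le_left
    refine squeeze_zero' (Filter.Eventually.of_forall fun n => norm_nonneg _) ?_ hlim
    filter_upwards [Filter.mem_inf_of_left (Filter.eventually_gt_atTop 0),
      Filter.mem_inf_of_right (Filter.mem_principal_self _)] with n hn he
    exact hle n hn he x
  · have hn' : (0 : ℝ) < n := by exact_mod_cast hn
    -- The geometric series doubles the constant, and 12/25 ≤ 1.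
    refine (Supermarket.tvDist_le (c := 6 / (25 * n)) fun x => ?_).trans ?_
    · rw [hη]
      exact (hπ n hn he).2 x
    · rw [← mul_div_assoc, div_le_div_iff₀ (by positivity) hn']
      linarith
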